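/- **Setting.** Let $(X_i,Y_i)_{i\ge 0}$ be i.i.d. with $X_i\in\mathbb R^d$, $Y_i\in\mathbb R$, following the model $Y=g(X)+\sigma(X)\epsilon$ with $\sigma>0$ on the support of $X$, where $\epsilon$ is independent of $X$, has mean zero and has density $f$. For every $n$, $\hat g=\hat g_n$ and $\hat\sigma=\hat\sigma_n$ are (arbitrary, jointly measurable) functions of training data and of $x$: $\hat g$ is fitted on a first training sample, $\hat\sigma$ on a second one (possibly using the first one as well). A calibration sample of $n$ further observations, disjoint from the training samples, gives the residuals $z_i=\{Y_i-\hat g(X_i)\}/\hat\sigma(X_i)$ and the kernel density estimate $\hat f(z)=\frac1{nh}\sum_i K\big(\frac{z_i-z}{h}\big)$ with bandwidth $h=h_n$. Let $0<\alpha<1$, let $\lambda^\alpha$ satisfy $\int_{\{f\le\lambda^\alpha\}}f=\alpha$, and let $\hat\lambda^\alpha$ be any level with $\int_{\{\hat f<\hat\lambda^\alpha\}}\hat f\le\alpha\le\int_{\{\hat f\le\hat\lambda^\alpha\}}\hat f$ (in particular, any solution of $\int_{\{\hat f\le\hat\lambda^\alpha\}}\hat f=\alpha$). Write $L_f(t)=\{z: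 f(z)>t\}$ and $d(z,A)=\inf_{y\in A}|z-y|$. **Assumptions.** 1. $K\ge 0$ is symmetric, $\|K\|_\infty=K(0)$, $\int|K|^r<\infty$ for all $r\ge1$, $\int K=1$, there are $\rho,C_\rho,t_0>0$ with $K(t)\le C_\rho e^{-|t|^\rho}$ for $|t|>t_0$, and $K$ has bounded variation on $\mathbb R$ (as is the case, for instance, if $K$ is non-increasing on $[0,\infty)$). 2. $f$ is bounded and Lipschitz continuous on $\mathbb R$. 3. $h\to0$ and $\log n/(nh)\to0$ as $n\to\infty$, and $h>\log n/n$. 4. $0<\beta<\infty$, and there are $\psi,\check C_\beta,\hat C_\beta>0$ and $\lambda_0<\lambda^\alpha-\psi$ such that $L_f(\lambda_0)$ has finite Lebesgue measure and, for all $\lambda^*\in[\lambda^\alpha-\psi,\lambda^\alpha+\psi]$ and $z\in L_f(\lambda_0)\setminus L_f(\lambda^*)$, $\check C_\beta\, d(z,L_f(\lambda^*))^\beta\le\lambda^*-f(z)\le\hat C_\beta\, d(z,L_f(\lambda^*))^\beta$. 5. There are $\tau_0,b_1,b_2>0$ with $b_1|\tau|\le\big|\int_{\{f\le\lambda^\alpha+\tau\}}f-\alpha\big|\le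 b_2|\tau|$ for all $|\tau|\le\tau_0$. 6. On the support of $X$, $g$ is bounded and $\sigma^2$ is bounded away from $0$ and $\infty$; and $L_f(\lambda^\alpha)$ is a bounded set. 7. $a_n,b_n\ge0$ are deterministic sequences tending to $0$ with $\sup_x|\hat g(x)-g(x)|=O(a_n)$ and $\sup_x|\hat\sigma(x)-\sigma(x)|=O(b_n)$ almost surely, where the suprema are taken over the support of $X$ and are random variables. 8. With $a(x)=\{g(x)-\hat g(x)\}/\hat\sigma(x)$ and $b(x)=\sigma(x)/\hat\sigma(x)$, it holds for almost every realization of $\hat g,\hat\sigma$ that $\sup_{z}\big|E_X[b(X)^{-1}f\{b(X)^{-1}(z-a(X))\}]-f(z)\big|=O(a_n+b_n)$, where the supremum is over the support of $f$ and $E_X$ is the expectation over $X$ with $\hat g,\hat\sigma$ held fixed. **Theorem.** For every $\varepsilon>0$ there is a constant $C$ (not depending on $n$, $x$ or the data) such that, for all sufficiently large $n$, with probability at least $1-O(1/n)-\varepsilon$, the following holds simultaneously for all $x$ in the support of $X$: $$d_H\big(\hat g(x)+\hat\sigma(x)\{z:\hat f(z)>\hat\lambda^\alpha\},\ g(x)+\sigma(x)\{z:f(z)>\lambda^\alpha\}\big)<C\Big\{a_n+b_n+\Big(h+\sqrt{\tfrac{\log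 n}{nh}}+a_n+b_n\Big)^{1/\beta}\Big\},$$ where $d_H(A,B)=\max\{\sup_{z\in A}d(z,B),\sup_{y\in B}d(y,A)\}$ is the Hausdorff distance. -/

import Mathlib

open MeasureTheory ProbabilityTheory Filter Topology Set
open scoped ENNReal NNReal

noncomputable section

namespace HPD

/-- The covariate space `ℝ^d`. -/
abbrev Cov (d : ℕ) := EuclideanSpace ℝ (Fin d)

/-! ### Level sets, cutoffs, kernel density estimates -/

/-- The upper level set `L_q(t) = {z : q z > t}`. -/
def upperSet (q : ℝ → ℝ) (t : ℝ) : Set ℝ := {z | t < q z}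

/-- `∫_{q ≤ t} q`; for a probability density `q` of `Z` this is `P(q(Z) ≤ t)`. -/
def massLE (q : ℝ → ℝ) (t : ℝ) : ℝ := ∫ z in {z | q z ≤ t}, q z

/-- `∫_{q < t} q`; for a probability density `q` of `Z` this is `P(q(Z) < t)`. -/
def massLT (q : ℝ → ℝ) (t : ℝ) : ℝ := ∫ z in {z | q z < t}, q z

/-- `t` is a highest-density cutoff of `q` at level `α`: `∫_{q < t} q ≤ α ≤ ∫_{q ≤ t} q`.
Every solution `t` of `∫_{q ≤ t} q = α` is one. Unlike that equation, which may be unsolvable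
when `q` has plateaus (e.g. for the estimate built from a box kernel), the condition can always
be met, see `exists_isCutoff`. -/
def IsCutoff (q : ℝ → ℝ) (α t : ℝ) : Prop := massLT q t ≤ α ∧ α ≤ massLE q t

/-- The kernel density estimate `z ↦ (n h)⁻¹ ∑_{i ∈ s} K ((vᵢ - z) / h)`, `n = |s|`. -/
def kde (K : ℝ → ℝ) (h : ℝ) (s : Finset ℕ) (v : ℕ → ℝ) (z : ℝ) : ℝ :=
  1 / ((s.card : ℝ) * h) * ∑ i ∈ s, K ((v i - z) / h)

/-- `c + s × A = {c + s z : z ∈ A}`. -/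
def locScale (c s : ℝ) (A : Set ℝ) : Set ℝ := (fun z => c + s * z) '' A

/-! ### The regression model -/

/-- The standardized regression error `ε_i = (Y_i - g(X_i)) / σ(X_i)`. -/
def stdError {Ω : Type*} {d : ℕ} (X : ℕ → Ω → Cov d) (Y : ℕ → Ω → ℝ) (g σ : Cov d → ℝ)
    (i : ℕ) (ω : Ω) : ℝ := (Y i ω - g (X i ω)) / σ (X i ω)

/-- The support of the covariate. -/
def covSupport {Ω : Type*} [MeasurableSpace Ω] (P : Measure Ω) {d : ℕ} (X : ℕ → Ω → Cov d) :
    Set (Cov d) := (P.map (X 0)).support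

/-- I.i.d. observations `(X_i, Y_i)` from `Y = g(X) + σ(X) ε`, where `σ > 0` and `ε` is
independent of `X`, has mean zero and has density `f`. -/
structure HeteroscedasticModel {Ω : Type*} [MeasurableSpace Ω] (P : Measure Ω) {d : ℕ}
    (X : ℕ → Ω → Cov d) (Y : ℕ → Ω → ℝ) (g σ : Cov d → ℝ) (f : ℝ → ℝ) : Prop where
  measurable_X : ∀ i, Measurable (X i)
  measurable_Y : ∀ i, Measurable (Y i)
  measurable_g : Measurable g
  measurable_σ : Measurable σ
  indep : iIndepFun (fun i ω => (X i ω, Y i ω)) P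
  identDistrib : ∀ i, IdentDistrib (fun ω => (X i ω, Y i ω)) (fun ω => (X 0 ω, Y 0 ω)) P P
  σ_pos : ∀ x ∈ covSupport P X, 0 < σ x
  indep_error : IndepFun (X 0) (stdError X Y g σ 0) P
  integrable_error : Integrable (stdError X Y g σ 0) P
  mean_error : ∫ ω, stdError X Y g σ 0 ω ∂P = 0
  f_nonneg : ∀ z, 0 ≤ f z
  f_measurable : Measurable f
  density : P.map (stdError X Y g σ 0) = volume.withDensity (fun z => ENNReal.ofReal (f z))

/-! ### Sample splitting and black-box estimators -/

/-- For each `n`: two training index sets, and a calibration index set of size `n` that meets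
neither of them. -/
structure Split where
  tr₁ : ℕ → Finset ℕ
  tr₂ : ℕ → Finset ℕ
  cal : ℕ → Finset ℕ
  disjoint₁ : ∀ n, Disjoint (tr₁ n) (cal n)
  disjoint₂ : ∀ n, Disjoint (tr₂ n) (cal n)
  card_cal : ∀ n, (cal n).card = n

/-- The observations with index in `s`. -/
def sample {Ω : Type*} {d : ℕ} (X : ℕ → Ω → Cov d) (Y : ℕ → Ω → ℝ) (s : Finset ℕ) (ω : Ω) :
    s → Cov d × ℝ := fun i => (X i ω, Y i ω)

/-- Arbitrary (jointly measurable) regression algorithms: the location is fitted on the first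
training sample, the scale on the second one, possibly using the fitted location. -/
structure Estimators (d : ℕ) (S : Split) where
  loc : ∀ n, (S.tr₁ n → Cov d × ℝ) → Cov d → ℝ
  scale : ∀ n, (S.tr₁ n → Cov d × ℝ) → (S.tr₂ n → Cov d × ℝ) → Cov d → ℝ
  measurable_loc : ∀ n,
    Measurable (fun p : (S.tr₁ n → Cov d × ℝ) × Cov d => loc n p.1 p.2)
  measurable_scale : ∀ n,
    Measurable (fun p : (S.tr₁ n → Cov d × ℝ) × (S.tr₂ n → Cov d × ℝ) × Cov d =>
      scale n p.1 p.2.1 p.2.2)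

section Estimates

variable {Ω : Type*} {d : ℕ} {S : Split}

/-- The fitted location function `ĝ_n`. -/
def gHat (E : Estimators d S) (X : ℕ → Ω → Cov d) (Y : ℕ → Ω → ℝ) (n : ℕ) (ω : Ω)
    (x : Cov d) : ℝ := E.loc n (sample X Y (S.tr₁ n) ω) x

/-- The fitted scale function `σ̂_n`. -/
def σHat (E : Estimators d S) (X : ℕ → Ω → Cov d) (Y : ℕ → Ω → ℝ) (n : ℕ) (ω : Ω)
    (x : Cov d) : ℝ := E.scale n (sample X Y (S.tr₁ n) ω) (sample X Y (S.tr₂ n) ω) x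

/-- The estimated standardized errors `z_i = (Y_i - ĝ_n(X_i)) / σ̂_n(X_i)`. -/
def residual (E : Estimators d S) (X : ℕ → Ω → Cov d) (Y : ℕ → Ω → ℝ) (n : ℕ) (ω : Ω)
    (i : ℕ) : ℝ := (Y i ω - gHat E X Y n ω (X i ω)) / σHat E X Y n ω (X i ω)

/-- The kernel density estimate `f̂_n` built from the calibration residuals. -/
def fHat (E : Estimators d S) (X : ℕ → Ω → Cov d) (Y : ℕ → Ω → ℝ) (K : ℝ → ℝ) (h : ℕ → ℝ)
    (n : ℕ) (ω : Ω) : ℝ → ℝ := kde K (h n) (S.cal n) (residual E X Y n ω)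

end Estimates

/-! ### Assumptions -/

/-- The conditions on the kernel: nonnegative, symmetric, largest at the origin, all powers
`r ≥ 1` integrable, integral one, (stretched) exponential tails, bounded variation. -/
structure KernelAssumption (K : ℝ → ℝ) : Prop where
  nonneg : ∀ z, 0 ≤ K z
  symm : ∀ z, K (-z) = K z
  le_zero : ∀ z, K z ≤ K 0
  integrable_rpow : ∀ r : ℝ, 1 ≤ r → Integrable (fun z => |K z| ^ r)
  integral_eq_one : ∫ z, K z = 1
  tail : ∃ ρ C t₀ : ℝ, 0 < ρ ∧ 0 < C ∧ 0 < t₀ ∧ ∀ t, t₀ < |t| → K t ≤ C * Real.exp (-|t| ^ ρ)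
  boundedVariation : BoundedVariationOn K univ

/-- Hölder smoothness of order `η`. -/
def HolderSmooth (f : ℝ → ℝ) (η : ℝ) : Prop :=
  ∃ C : ℝ, 0 < C ∧ ∀ z z', |f z - f z'| ≤ C * |z - z'| ^ η

/-- `β`-regularity of the level sets of `f` around the level `lam`. -/
def LevelRegular (f : ℝ → ℝ) (lam β : ℝ) : Prop :=
  ∃ lam₀ ψ C₁ C₂ : ℝ, 0 < ψ ∧ 0 < C₁ ∧ 0 < C₂ ∧ lam₀ < lam - ψ ∧
    (∀ t ∈ Icc (lam - ψ) (lam + ψ), ∀ z ∈ upperSet f lam₀ \ upperSet f t,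
      C₁ * Metric.infDist z (upperSet f t) ^ β ≤ t - f z ∧
      t - f z ≤ C₂ * Metric.infDist z (upperSet f t) ^ β) ∧
    volume (upperSet f lam₀) < ∞

/-- The `γ`-exponent condition at level `lam`. -/
def GammaExponent (f : ℝ → ℝ) (α lam γ : ℝ) : Prop :=
  ∃ τ₀ b₁ b₂ : ℝ, 0 < τ₀ ∧ 0 < b₁ ∧ 0 < b₂ ∧ ∀ τ ∈ Icc (-τ₀) τ₀,
    b₁ * |τ| ^ γ ≤ |massLE f (lam + τ) - α| ∧ |massLE f (lam + τ) - α| ≤ b₂ * |τ| ^ γ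

/-- `sup_{x ∈ A} |u x - v x|`. -/
def supDev {d : ℕ} (A : Set (Cov d)) (u v : Cov d → ℝ) : ℝ≥0∞ :=
  ⨆ x ∈ A, ENNReal.ofReal |u x - v x|

/-- `sup_{x ∈ A} |θ̂_n x - θ x|` is a random variable and is `O(r_n)` almost surely. -/
def UniformStrongRate {Ω : Type*} [MeasurableSpace Ω] (P : Measure Ω) {d : ℕ}
    (A : Set (Cov d)) (θHat : ℕ → Ω → Cov d → ℝ) (θ : Cov d → ℝ) (r : ℕ → ℝ) : Prop :=
  (∀ n, AEMeasurable (fun ω => supDev A (θHat n ω) θ) P) ∧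
  ∀ᵐ ω ∂P, ∃ C : ℝ≥0, ∀ᶠ n in atTop, supDev A (θHat n ω) θ ≤ C * ENNReal.ofReal (r n)

/-- Conditionally on the training data, with `a(x) = (g x - ĝ x) / σ̂ x` and `b(x) = σ x / σ̂ x`,
`sup_z |E[b(X)⁻¹ f(b(X)⁻¹ (z - a(X)))] - f z| = O(r_n)` over the support of `f`; the
expectation is over `X` only. -/
def ResidualDensityRate {Ω : Type*} [MeasurableSpace Ω] (P : Measure Ω) {d : ℕ}
    (X : ℕ → Ω → Cov d) (gh σh : ℕ → Ω → Cov d → ℝ) (g σ : Cov d → ℝ) (f : ℝ → ℝ)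
    (r : ℕ → ℝ) : Prop :=
  ∀ᵐ ω ∂P, ∃ C : ℝ, ∀ᶠ n in atTop, ∀ z ∈ tsupport f,
    |(∫ x, (σ x / σh n ω x)⁻¹ *
        f ((σ x / σh n ω x)⁻¹ * (z - (σh n ω x)⁻¹ * (g x - gh n ω x))) ∂(P.map (X 0))) - f z|
      ≤ C * r n

/-! ### Cutoffs exist -/

theorem exists_isCutoff {q : ℝ → ℝ} (hq : ∀ z, 0 ≤ q z) (hm : Measurable q)
    (h1 : ∫ z, q z = 1) {α : ℝ} (h0α : 0 < α) (hα1 : α < 1) : ∃ t, IsCutoff q α t := by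
  have hi : Integrable q := by
    by_contra h
    rw [integral_undef h] at h1
    exact zero_ne_one h1
  have mono : Monotone (massLE q) := fun s t hst =>
    setIntegral_mono_set hi.integrableOn (ae_of_all _ hq)
      (LE.le.eventuallyLE (fun z (hz : q z ≤ s) => hz.trans hst))
  have hneg : ∀ t < 0, massLE q t = 0 := by
    intro t ht
    have : {z | q z ≤ t} = ∅ := by
      ext z
      simpa using lt_of_lt_of_le ht (hq z)
    simp [massLE, this]
  -- the mass tends to one
  have htop : Tendsto (fun n : ℕ => massLE q n) atTop (𝓝 1) := by
    have := tendsto_setIntegral_of_monotone (μ := volume) (f := q)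
      (s := fun n : ℕ => {z | q z ≤ n}) (fun n => hm measurableSet_Iic)
      (fun m n hmn z (hz : q z ≤ m) => hz.trans (by exact_mod_cast hmn)) hi.integrableOn
    have hu : (⋃ n : ℕ, {z | q z ≤ n}) = univ := by
      ext z
      simpa using exists_nat_ge (q z)
    rwa [hu, setIntegral_univ, h1] at this
  set T : Set ℝ := {t | α ≤ massLE q t} with hT
  have hne : T.Nonempty := by
    obtain ⟨n, hn⟩ := (htop.eventually (lt_mem_nhds hα1)).exists
    exact ⟨n, hn.le⟩
  have hbdd : BddBelow T := by
    refine ⟨0, fun t ht => ?_⟩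
    by_contra h
    have h2 : α ≤ massLE q t := ht
    rw [hneg t (not_le.mp h)] at h2
    exact absurd h2 (not_le.mpr h0α)
  obtain ⟨u, hu_anti, hu_gt, hu_lim⟩ := exists_seq_strictAnti_tendsto (sInf T)
  obtain ⟨w, hw_mono, hw_lt, hw_lim⟩ := exists_seq_strictMono_tendsto (sInf T)
  refine ⟨sInf T, ?_, ?_⟩
  · have hl := tendsto_setIntegral_of_monotone (μ := volume) (f := q)
      (s := fun n : ℕ => {z | q z ≤ w n}) (fun n => hm measurableSet_Iic)
      (fun m n hmn z (hz : q z ≤ w m) => hz.trans (hw_mono.monotone hmn)) hi.integrableOn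
    have hU : (⋃ n : ℕ, {z | q z ≤ w n}) = {z | q z < sInf T} := by
      ext z
      simp only [mem_iUnion, mem_ofPred_eq]
      constructor
      · rintro ⟨n, hn⟩
        exact hn.trans_lt (hw_lt n)
      · intro hz
        obtain ⟨n, hn⟩ := (hw_lim.eventually (lt_mem_nhds hz)).exists
        exact ⟨n, hn.le⟩
    rw [hU] at hl
    refine le_of_tendsto hl (Eventually.of_forall fun n => ?_)
    by_contra h
    exact absurd (csInf_le hbdd (show w n ∈ T from (not_le.mp h).le)) (not_le.mpr (hw_lt n))
  · have hl := tendsto_setIntegral_of_antitone (μ := volume) (f := q)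
      (s := fun n : ℕ => {z | q z ≤ u n}) (fun n => hm measurableSet_Iic)
      (fun m n hmn z (hz : q z ≤ u n) => hz.trans (hu_anti.antitone hmn)) ⟨0, hi.integrableOn⟩
    have hI : (⋂ n : ℕ, {z | q z ≤ u n}) = {z | q z ≤ sInf T} := by
      ext z
      simp only [mem_iInter, mem_ofPred_eq]
      constructor
      · intro hz
        exact ge_of_tendsto' hu_lim hz
      · intro hz n
        exact hz.trans (hu_gt n).le
    rw [hI] at hl
    refine ge_of_tendsto hl (Eventually.of_forall fun n => ?_)
    obtain ⟨t, ht, htu⟩ := exists_lt_of_csInf_lt hne (hu_gt n)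
    exact le_trans ht (mono htu.le)

end HPD

end

/-! The argument has a deterministic half and a probabilistic half.

Deterministic half. Let `q` be a density with `|q - f| ≤ δ` on `[-R, R]`, and let both functions
stay below `lam - ψ` elsewhere. The `γ`-exponent condition (here with exponent one) says that moving
the level by `τ` moves the mass of `f` by at least `b₁ |τ|`, while on `[-R, R]` the masses of `q`
and `f` differ by at most `2Rδ`. Hence the two cutoffs differ by `O(δ)` (`abs_cutoff_sub_le`). The
level sets are then nested up to a shift of the level by `O(δ)`, and `β`-regularity turns such a
shift into a distance `O(δ^(1/β))` (`highestDensityRegion_near`). Relocating and rescaling by the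
fitted instead of the true functions adds `O(a_n + b_n)` (`hausdorffEDist_locScale_le`).

Probabilistic half: `δ = O(h + √(log n / (n h)) + a_n + b_n)` for `q = fHat`. Given the training
data the calibration residuals are i.i.d., with the law of `a(X) + b(X) ε`.

Bias: `f` is bounded and Lipschitz, `K` has a finite first moment, `b` is near one and `a` near
zero, so smoothing that law by the kernel reproduces `f` up to `O(h + a_n + b_n)` on bounded sets.
Far out only an upper bound is needed (`abs_integral_kernel_affine_sub_le`,
`integral_kernel_affine_le_of_far`).

Deviation: an interval of length of order `h` has mass `O(h)`, so Bernstein's inequality on a grid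
of about `n²` quantile intervals bounds the error of all relative frequencies at that scale by
`O(√(h log n / n))` (`measureReal_exists_Ioc_deviation_le`). As `K` has bounded variation, its
integrals against the empirical and the true law differ by a constant times this error, whatever the
location (`KernelAssumption.exists_abs_integral_sub_le`). Division by `h` gives the rate.

The exceptional probability is `8 / n` from the deviation, plus `ε` for replacing the random
constants in the almost sure rates by a deterministic one (`exists_measurableSet_supDev_le`). -/

namespace HPD

/-! ### Integrals of functions of bounded variation against measures close on short intervals -/

/-- An upper part of `(s, t]` is either `(c, t]`, covered by the hypothesis, or `[c, t]`, a
decreasing limit of such intervals. The superlevel sets of a monotone function on a cell are of this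
kind. -/
lemma abs_measureReal_sub_le_of_upper {μ ν : Measure ℝ} [IsFiniteMeasure μ] [IsFiniteMeasure ν]
    {D s t : ℝ} (hD : 0 ≤ D)
    (h : ∀ c, s ≤ c → c ≤ t → |μ.real (Ioc c t) - ν.real (Ioc c t)| ≤ D)
    {J : Set ℝ} (hJ : J ⊆ Ioc s t) (hup : ∀ x ∈ J, ∀ y ∈ Ioc s t, x ≤ y → y ∈ J) :
    |μ.real J - ν.real J| ≤ D := by
  rcases J.eq_empty_or_nonempty with rfl | hne
  · simpa using hD
  have hbdd : BddBelow J := ⟨s, fun x hx => (hJ hx).1.le⟩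
  set c := sInf J with hc
  have hsc : s ≤ c := le_csInf hne fun x hx => (hJ hx).1.le
  have hct : c ≤ t := by
    obtain ⟨x, hx⟩ := hne
    exact (csInf_le hbdd hx).trans (hJ hx).2
  by_cases hcJ : c ∈ J
  · have hJe : J = Icc c t := by
      ext x
      refine ⟨fun hx => ⟨csInf_le hbdd hx, (hJ hx).2⟩, fun hx => hup c hcJ x ⟨?_, hx.2⟩ hx.1⟩
      exact (hJ hcJ).1.trans_le hx.1
    have hsc' : s < c := (hJ hcJ).1
    obtain ⟨u, hu_mono, hu_mem, hu_lim⟩ := exists_seq_strictMono_tendsto' hsc'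
    have key : ∀ (ρ : Measure ℝ) [IsFiniteMeasure ρ],
        Tendsto (fun n => ρ.real (Ioc (u n) t)) atTop (𝓝 (ρ.real J)) := by
      intro ρ _
      have hI : (⋂ n, Ioc (u n) t) = J := by
        rw [hJe]
        ext x
        simp only [mem_iInter, mem_Ioc, mem_Icc]
        constructor
        · intro hx
          exact ⟨le_of_tendsto' hu_lim fun n => (hx n).1.le, (hx 0).2⟩
        · intro hx n
          exact ⟨(hu_mem n).2.trans_le hx.1, hx.2⟩
      have := tendsto_measure_iInter_atTop (μ := ρ) (s := fun n => Ioc (u n) t)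
        (fun n => measurableSet_Ioc.nullMeasurableSet)
        (fun m n hmn => Ioc_subset_Ioc_left (hu_mono.monotone hmn)) ⟨0, measure_ne_top _ _⟩
      rw [hI] at this
      exact (ENNReal.tendsto_toReal (measure_ne_top _ _)).comp this
    refine le_of_tendsto' ((key μ).sub (key ν)).abs fun n => ?_
    exact h _ (hu_mem n).1.le ((hu_mem n).2.le.trans hct)
  · have hJe : J = Ioc c t := by
      ext x
      constructor
      · intro hx
        exact ⟨lt_of_le_of_ne (csInf_le hbdd hx) fun he => hcJ (he ▸ hx), (hJ hx).2⟩
      · intro hx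
        obtain ⟨y, hy, hyx⟩ := exists_lt_of_csInf_lt hne hx.1
        exact hup y hy x ⟨(hJ hy).1.trans hyx, hx.2⟩ hyx.le
    rw [hJe]
    exact h c hsc hct

/-- The layer-cake formula. Levels above `φ t - φ s` have empty superlevel sets, so the range of
integration is bounded and a uniform error `D` in the measures costs only `(φ t - φ s) * D`. -/
lemma setIntegral_sub_left_eq_integral_superlevel {μ : Measure ℝ} [IsFiniteMeasure μ]
    {φ : ℝ → ℝ} (hφ : Monotone φ) {s t : ℝ} :
    ∫ w in Ioc s t, (φ w - φ s) ∂μ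
      = ∫ τ in Ioc 0 (φ t - φ s), μ.real {w | w ∈ Ioc s t ∧ τ < φ w - φ s} := by
  have hint : Integrable (fun w => φ w - φ s) (μ.restrict (Ioc s t)) := by
    refine Integrable.of_bound (C := φ t - φ s)
      (hφ.measurable.sub_const _).aestronglyMeasurable ?_
    filter_upwards [ae_restrict_mem measurableSet_Ioc] with w hw
    rw [Real.norm_eq_abs, abs_of_nonneg (sub_nonneg.2 (hφ hw.1.le))]
    exact sub_le_sub_right (hφ hw.2) _
  rw [hint.integral_eq_integral_meas_lt]
  · have hset : ∀ τ : ℝ, (μ.restrict (Ioc s t)).real {w | τ < φ w - φ s}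
        = μ.real {w | w ∈ Ioc s t ∧ τ < φ w - φ s} := by
      intro τ
      rw [measureReal_restrict_apply
        (measurableSet_lt measurable_const (hφ.measurable.sub_const _))]
      congr 1
      ext w
      exact and_comm
    simp_rw [hset]
    refine setIntegral_eq_of_subset_of_forall_sdiff_eq_zero measurableSet_Ioi
      Ioc_subset_Ioi_self ?_
    intro τ hτ
    have : {w | w ∈ Ioc s t ∧ τ < φ w - φ s} = ∅ := by
      ext w
      simp only [mem_ofPred_eq, mem_empty_iff_false, iff_false, not_and, not_lt]
      intro hw
      by_contra! hlt
      refine hτ.2 ⟨hτ.1, hlt.le.trans (sub_le_sub_right (hφ hw.2) _)⟩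
    rw [this, measureReal_empty]
  · filter_upwards [ae_restrict_mem measurableSet_Ioc] with w hw
    exact sub_nonneg.2 (hφ hw.1.le)

lemma abs_setIntegral_monotone_sub_le {μ ν : Measure ℝ} [IsFiniteMeasure μ] [IsFiniteMeasure ν]
    {D s t : ℝ} (hD : 0 ≤ D) (hst : s ≤ t)
    (h : ∀ c, s ≤ c → c ≤ t → |μ.real (Ioc c t) - ν.real (Ioc c t)| ≤ D)
    {φ : ℝ → ℝ} (hφ : Monotone φ) :
    |∫ w in Ioc s t, (φ w - φ s) ∂μ - ∫ w in Ioc s t, (φ w - φ s) ∂ν| ≤ (φ t - φ s) * D := by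
  rw [setIntegral_sub_left_eq_integral_superlevel hφ,
    setIntegral_sub_left_eq_integral_superlevel hφ]
  have hint : ∀ (ρ : Measure ℝ) [IsFiniteMeasure ρ],
      IntegrableOn (fun τ => ρ.real {w | w ∈ Ioc s t ∧ τ < φ w - φ s}) (Ioc 0 (φ t - φ s)) := by
    intro ρ _
    have hanti : Antitone fun τ => ρ.real {w | w ∈ Ioc s t ∧ τ < φ w - φ s} := by
      intro x y hxy
      exact measureReal_mono fun w hw => ⟨hw.1, hxy.trans_lt hw.2⟩
    refine Integrable.of_bound (C := ρ.real univ) hanti.measurable.aestronglyMeasurable ?_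
    refine ae_of_all _ fun τ => ?_
    rw [Real.norm_eq_abs, abs_of_nonneg measureReal_nonneg]
    exact measureReal_mono (subset_univ _)
  rw [← integral_sub (hint μ) (hint ν)]
  have := norm_setIntegral_le_of_norm_le_const (μ := volume) (s := Ioc 0 (φ t - φ s)) (C := D)
    (f := fun τ => μ.real {w | w ∈ Ioc s t ∧ τ < φ w - φ s}
      - ν.real {w | w ∈ Ioc s t ∧ τ < φ w - φ s}) (by simp) ?_
  · rw [Real.norm_eq_abs] at this
    refine this.trans_eq ?_
    rw [Real.volume_real_Ioc_of_le (sub_nonneg.2 (hφ hst))]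
    ring
  · intro τ _
    refine abs_measureReal_sub_le_of_upper hD h (fun w hw => hw.1) ?_
    intro x hx y hy hxy
    exact ⟨hy, hx.2.trans_le (sub_le_sub_right (hφ hxy) _)⟩

/-- Jordan decomposition, with `V` the variation from `0` and `W = V - K`. The oscillation of `W` is
at most that of `V` plus that of `K`, so twice the total variation serves for both. -/
lemma exists_monotone_decomposition {K : ℝ → ℝ} (hK : BoundedVariationOn K univ) :
    ∃ (V W : ℝ → ℝ) (T : ℝ), Monotone V ∧ Monotone W ∧ (∀ x, K x = V x - W x) ∧
      (∀ x y, V y - V x ≤ T) ∧ ∀ x y, W y - W x ≤ T := by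
  have hloc : LocallyBoundedVariationOn K univ := hK.locallyBoundedVariationOn
  set V : ℝ → ℝ := variationOnFromTo K univ 0 with hV
  have hVm : Monotone V := monotoneOn_univ.1 (variationOnFromTo.monotoneOn hloc (mem_univ 0))
  have hWm : Monotone (V - K) :=
    monotoneOn_univ.1 (variationOnFromTo.sub_self_monotoneOn hloc (mem_univ 0))
  have hVT : ∀ x y, V y - V x ≤ (eVariationOn K univ).toReal := by
    intro x y
    rcases le_total x y with hxy | hxy
    · have : V y - V x = variationOnFromTo K univ x y := by
        rw [hV, sub_eq_iff_eq_add, add_comm]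
        exact (variationOnFromTo.add hloc (mem_univ 0) (mem_univ x) (mem_univ y)).symm
      rw [this, variationOnFromTo.eq_of_le _ _ hxy]
      exact ENNReal.toReal_mono hK (eVariationOn.mono _ inter_subset_left)
    · exact (sub_nonpos.2 (hVm hxy)).trans ENNReal.toReal_nonneg
  refine ⟨V, V - K, 2 * (eVariationOn K univ).toReal, hVm, hWm, fun x => by simp, ?_, ?_⟩
  · intro x y
    have := hVT x y
    have := ENNReal.toReal_nonneg (a := eVariationOn K univ)
    linarith
  · intro x y
    have h1 := hVT x y
    have h2 := hK.sub_le (mem_univ x) (mem_univ y)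
    simp only [Pi.sub_apply]
    linarith

lemma KernelAssumption.measurable {K : ℝ → ℝ} (hK : KernelAssumption K) : Measurable K := by
  obtain ⟨V, W, T, hV, hW, hKVW, -, -⟩ := exists_monotone_decomposition hK.boundedVariation
  have : K = fun x => V x - W x := funext hKVW
  rw [this]
  exact hV.measurable.sub hW.measurable

lemma KernelAssumption.integrable {K : ℝ → ℝ} (hK : KernelAssumption K) : Integrable K := by
  have := hK.integrable_rpow 1 le_rfl
  simpa [abs_of_nonneg (hK.nonneg _)] using this

lemma KernelAssumption.integrable_abs_mul {K : ℝ → ℝ} (hK : KernelAssumption K) :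
    Integrable (fun u => |u| * K u) := by
  obtain ⟨ρ, C, t₀, hρ, hC, ht₀, htail⟩ := hK.tail
  -- Were the function not integrable, its integral would be `0` by convention, whereas the Gamma
  -- integral formula gives a positive value.
  have hexp : IntegrableOn (fun x : ℝ => x ^ (1 : ℝ) * Real.exp (-x ^ ρ)) (Ioi 0) := by
    by_contra hnot
    have h0 := integral_undef hnot
    rw [integral_rpow_mul_exp_neg_rpow hρ (by norm_num)] at h0
    have : 0 < 1 / ρ * Real.Gamma ((1 + 1) / ρ) :=
      mul_pos (by positivity) (Real.Gamma_pos_of_pos (by positivity))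
    exact this.ne' h0
  have hexp' : Integrable (fun x : ℝ => |x| * Real.exp (-|x| ^ ρ)) := by
    have h1 : IntegrableOn (fun x : ℝ => |x| * Real.exp (-|x| ^ ρ)) (Ioi 0) := by
      refine hexp.congr_fun (fun x hx => ?_) measurableSet_Ioi
      simp [abs_of_pos (mem_Ioi.1 hx)]
    have h2 : IntegrableOn (fun x : ℝ => |x| * Real.exp (-|x| ^ ρ)) (Iic 0) := by
      rw [integrableOn_Iic_iff_integrableOn_Iio]
      have := (Measure.measurePreserving_neg (volume : Measure ℝ)).integrableOn_comp_preimage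
        (Homeomorph.neg ℝ).measurableEmbedding
        (f := fun x : ℝ => |x| * Real.exp (-|x| ^ ρ)) (s := Ioi 0)
      simpa [Function.comp_def] using this.2 h1
    rw [← integrableOn_univ, ← Iic_union_Ioi (a := (0 : ℝ))]
    exact h2.union h1
  refine ((hK.integrable.const_mul t₀).add (hexp'.const_mul C)).mono'
    (measurable_abs.mul hK.measurable).aestronglyMeasurable (ae_of_all _ fun u => ?_)
  rw [Real.norm_eq_abs, abs_of_nonneg (mul_nonneg (abs_nonneg _) (hK.nonneg _))]
  simp only [Pi.add_apply]
  rcases le_or_gt |u| t₀ with hu | hu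
  · have := mul_le_mul_of_nonneg_right hu (hK.nonneg u)
    have : 0 ≤ C * (|u| * Real.exp (-|u| ^ ρ)) := by positivity
    linarith
  · have h1 := mul_le_mul_of_nonneg_left (htail u hu) (abs_nonneg u)
    have h2 := mul_nonneg ht₀.le (hK.nonneg u)
    linarith

/-- On a unit cell, `K` is the constant `K s` plus a difference of monotone functions vanishing at
`s`. The value `|K s|` is traded for the mean of `|K|` over the cell plus its oscillation: these,
unlike the sampled values, are additive over cells and so have a bounded sum. -/
lemma abs_setIntegral_kernel_sub_le {μ ν : Measure ℝ} [IsFiniteMeasure μ] [IsFiniteMeasure ν]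
    {D : ℝ} (hD : 0 ≤ D) {s : ℝ}
    (h : ∀ c d, c ≤ d → d ≤ c + 1 → |μ.real (Ioc c d) - ν.real (Ioc c d)| ≤ D)
    {K V W : ℝ → ℝ} (hK : Integrable K) (hV : Monotone V) (hW : Monotone W)
    (hKVW : ∀ x, K x = V x - W x) :
    |∫ w in Ioc s (s + 1), K w ∂μ - ∫ w in Ioc s (s + 1), K w ∂ν|
      ≤ ((∫ w in Ioc s (s + 1), |K w|) + 2 * (V (s + 1) - V s) + 2 * (W (s + 1) - W s)) * D := by
  have hs : s ≤ s + 1 := by linarith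
  have hc : ∀ c, s ≤ c → c ≤ s + 1 → |μ.real (Ioc c (s + 1)) - ν.real (Ioc c (s + 1))| ≤ D :=
    fun c h1 h2 => h c _ h2 (by linarith)
  have h1 := abs_setIntegral_monotone_sub_le hD hs hc hV
  have h2 := abs_setIntegral_monotone_sub_le hD hs hc hW
  have h3 := hc s le_rfl hs
  have hint : ∀ {φ : ℝ → ℝ}, Monotone φ → ∀ (ρ : Measure ℝ) [IsFiniteMeasure ρ],
      Integrable (fun w => φ w - φ s) (ρ.restrict (Ioc s (s + 1))) := by
    intro φ hφ ρ _
    refine Integrable.of_bound (C := φ (s + 1) - φ s)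
      (hφ.measurable.sub_const _).aestronglyMeasurable ?_
    filter_upwards [ae_restrict_mem measurableSet_Ioc] with w hw
    rw [Real.norm_eq_abs, abs_of_nonneg (sub_nonneg.2 (hφ hw.1.le))]
    exact sub_le_sub_right (hφ hw.2) _
  have hsplit : ∀ (ρ : Measure ℝ) [IsFiniteMeasure ρ], ∫ w in Ioc s (s + 1), K w ∂ρ
      = K s * ρ.real (Ioc s (s + 1)) + (∫ w in Ioc s (s + 1), (V w - V s) ∂ρ
        - ∫ w in Ioc s (s + 1), (W w - W s) ∂ρ) := by
    intro ρ _
    have : ∀ w, K w = K s + ((V w - V s) - (W w - W s)) := fun w => by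
      rw [hKVW, hKVW s]; ring
    rw [← integral_sub (hint hV ρ) (hint hW ρ)]
    calc ∫ w in Ioc s (s + 1), K w ∂ρ
        = ∫ w in Ioc s (s + 1), (K s + ((V w - V s) - (W w - W s))) ∂ρ := by
          simp_rw [← this]
      _ = _ := by
          rw [integral_add (integrable_const _) (by exact (hint hV ρ).sub (hint hW ρ))]
          simp [mul_comm]
  have hKs : |K s| ≤ (∫ w in Ioc s (s + 1), |K w|) + (V (s + 1) - V s) + (W (s + 1) - W s) := by
    have hle : ∫ _ in Ioc s (s + 1), (|K s| - ((V (s + 1) - V s) + (W (s + 1) - W s)))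
        ≤ ∫ w in Ioc s (s + 1), |K w| := by
      refine setIntegral_mono_on (integrable_const _) hK.abs.integrableOn measurableSet_Ioc ?_
      intro w hw
      have a1 := hV hw.1.le
      have a2 := hV hw.2
      have a3 := hW hw.1.le
      have a4 := hW hw.2
      have a5 : |K s| ≤ |K w| + |K s - K w| := by
        have := abs_add_le (K w) (K s - K w)
        simpa using this
      have a6 : |K s - K w| ≤ (V (s + 1) - V s) + (W (s + 1) - W s) := by
        rw [hKVW, hKVW w, abs_le]
        constructor <;> linarith
      linarith
    simp only [setIntegral_const, Real.volume_real_Ioc_of_le hs] at hle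
    simp only [add_sub_cancel_left, one_smul] at hle
    linarith
  rw [hsplit μ, hsplit ν]
  have h4 : |K s * (μ.real (Ioc s (s + 1)) - ν.real (Ioc s (s + 1)))|
      ≤ ((∫ w in Ioc s (s + 1), |K w|) + (V (s + 1) - V s) + (W (s + 1) - W s)) * D := by
    rw [abs_mul]
    exact mul_le_mul hKs h3 (abs_nonneg _) ((abs_nonneg _).trans hKs)
  rw [abs_le] at *
  constructor <;> linarith [h1.1, h1.2, h2.1, h2.2, h4.1, h4.2]

lemma abs_integral_kernel_sub_le {μ ν : Measure ℝ} [IsFiniteMeasure μ] [IsFiniteMeasure ν]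
    {D : ℝ} (hD : 0 ≤ D)
    (h : ∀ c d, c ≤ d → d ≤ c + 1 → |μ.real (Ioc c d) - ν.real (Ioc c d)| ≤ D)
    {K V W : ℝ → ℝ} {T : ℝ} (hK : Integrable K) (hV : Monotone V) (hW : Monotone W)
    (hKVW : ∀ x, K x = V x - W x) (hVT : ∀ x y, V y - V x ≤ T) (hWT : ∀ x y, W y - W x ≤ T)
    (hKμ : Integrable K μ) (hKν : Integrable K ν) :
    |∫ w, K w ∂μ - ∫ w, K w ∂ν| ≤ ((∫ w, |K w|) + 4 * T) * D := by
  -- Unit cells are added one at a time from `-N`; the increments of `V` and `W` telescope.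
  have hsum : ∀ (N m : ℕ), |∫ w in Ioc (-(N : ℝ)) (-N + m), K w ∂μ
        - ∫ w in Ioc (-(N : ℝ)) (-N + m), K w ∂ν|
      ≤ ((∫ w in Ioc (-(N : ℝ)) (-N + m), |K w|) + 2 * (V (-N + m) - V (-N))
        + 2 * (W (-N + m) - W (-N))) * D := by
    intro N m
    induction m with
    | zero => simp
    | succ m ih =>
      have hU : Ioc (-(N : ℝ)) (-N + (m + 1 : ℕ))
          = Ioc (-(N : ℝ)) (-N + m) ∪ Ioc (-(N : ℝ) + m) (-N + m + 1) := by
        rw [Ioc_union_Ioc_eq_Ioc]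
        · push_cast; ring_nf
        · have : (0 : ℝ) ≤ m := by positivity
          linarith
        · linarith
      have hdis : Disjoint (Ioc (-(N : ℝ)) (-N + m)) (Ioc (-(N : ℝ) + m) (-N + m + 1)) :=
        Ioc_disjoint_Ioc_of_le le_rfl
      have hcell := abs_setIntegral_kernel_sub_le hD (s := -(N : ℝ) + m) h hK hV hW hKVW
      have hend : -(N : ℝ) + (m + 1 : ℕ) = -N + m + 1 := by push_cast; ring
      rw [hU, setIntegral_union hdis measurableSet_Ioc hKμ.integrableOn hKμ.integrableOn,
        setIntegral_union hdis measurableSet_Ioc hKν.integrableOn hKν.integrableOn,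
        setIntegral_union hdis measurableSet_Ioc hK.abs.integrableOn hK.abs.integrableOn, hend]
      rw [abs_le] at *
      constructor <;> linarith [ih.1, ih.2, hcell.1, hcell.2]
  have hsum' : ∀ N : ℕ, |∫ w in Ioc (-(N : ℝ)) N, K w ∂μ - ∫ w in Ioc (-(N : ℝ)) N, K w ∂ν|
      ≤ ((∫ w, |K w|) + 4 * T) * D := by
    intro N
    have h1 := hsum N (2 * N)
    have h2 : -(N : ℝ) + (2 * N : ℕ) = N := by push_cast; ring
    rw [h2] at h1
    refine h1.trans (mul_le_mul_of_nonneg_right ?_ hD)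
    have h3 : ∫ w in Ioc (-(N : ℝ)) N, |K w| ≤ ∫ w, |K w| :=
      setIntegral_le_integral hK.abs (ae_of_all _ fun w => abs_nonneg _)
    linarith [hVT (-N) N, hWT (-N) N]
  have hlim : ∀ (ρ : Measure ℝ), Integrable K ρ →
      Tendsto (fun N : ℕ => ∫ w in Ioc (-(N : ℝ)) N, K w ∂ρ) atTop (𝓝 (∫ w, K w ∂ρ)) := by
    intro ρ hρ
    have := tendsto_setIntegral_of_monotone (μ := ρ) (f := K)
      (s := fun N : ℕ => Ioc (-(N : ℝ)) N) (fun N => measurableSet_Ioc)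
      (fun m n hmn => Ioc_subset_Ioc (by simpa using hmn) (by simpa using hmn)) hρ.integrableOn
    have hu : (⋃ N : ℕ, Ioc (-(N : ℝ)) N) = univ := by
      ext x
      simp only [mem_iUnion, mem_Ioc, mem_univ, iff_true]
      obtain ⟨N, hN⟩ := exists_nat_gt |x|
      exact ⟨N, by linarith [neg_abs_le x], (le_abs_self x).trans hN.le⟩
    rwa [hu, setIntegral_univ] at this
  exact le_of_tendsto' ((hlim μ hKμ).sub (hlim ν hKν)).abs hsum'

/-- A kernel integrates two measures alike, uniformly over its location, as soon as they agree on
intervals of the length of the bandwidth. -/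
lemma KernelAssumption.exists_abs_integral_sub_le {K : ℝ → ℝ} (hK : KernelAssumption K) :
    ∃ C : ℝ, 0 < C ∧ ∀ (μ ν : Measure ℝ) [IsProbabilityMeasure μ] [IsProbabilityMeasure ν]
      (h D : ℝ), 0 < h → 0 ≤ D →
      (∀ c d, c ≤ d → d ≤ c + h → |μ.real (Ioc c d) - ν.real (Ioc c d)| ≤ D) →
      ∀ z, |∫ w, K ((w - z) / h) ∂μ - ∫ w, K ((w - z) / h) ∂ν| ≤ C * D := by
  obtain ⟨V, W, T, hV, hW, hKVW, hVT, hWT⟩ := exists_monotone_decomposition hK.boundedVariation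
  have hT : 0 ≤ T := by simpa using hVT 0 0
  refine ⟨(∫ w, |K w|) + 4 * T, ?_, ?_⟩
  · have : ∫ w, |K w| = 1 := by
      simp_rw [abs_of_nonneg (hK.nonneg _)]
      exact hK.integral_eq_one
    linarith
  intro μ ν _ _ h D hh hD hclose z
  -- Pushing forward by `w ↦ (w - z) / h` reduces everything to bandwidth one and location zero;
  -- intervals of length `h` become unit intervals.
  have hm : Measurable fun w : ℝ => (w - z) / h := by fun_prop
  have hp : ∀ (ρ : Measure ℝ) [IsProbabilityMeasure ρ],
      IsProbabilityMeasure (ρ.map fun w => (w - z) / h) :=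
    fun ρ _ => Measure.isProbabilityMeasure_map hm.aemeasurable
  have := hp μ
  have := hp ν
  have hKi : ∀ (ρ : Measure ℝ) [IsProbabilityMeasure ρ],
      Integrable K ρ := by
    intro ρ _
    refine Integrable.of_bound (C := K 0) hK.measurable.aestronglyMeasurable (ae_of_all _ fun w => ?_)
    rw [Real.norm_eq_abs, abs_of_nonneg (hK.nonneg w)]
    exact hK.le_zero w
  have hIoc : ∀ (ρ : Measure ℝ) [IsProbabilityMeasure ρ] (c d : ℝ),
      (ρ.map fun w => (w - z) / h).real (Ioc c d) = ρ.real (Ioc (z + h * c) (z + h * d)) := by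
    intro ρ _ c d
    rw [map_measureReal_apply hm measurableSet_Ioc]
    congr 1
    ext w
    simp only [mem_preimage, mem_Ioc, lt_div_iff₀ hh, div_le_iff₀ hh]
    constructor <;> rintro ⟨h1, h2⟩ <;> constructor <;> linarith
  have key := abs_integral_kernel_sub_le (μ := μ.map fun w => (w - z) / h)
    (ν := ν.map fun w => (w - z) / h) hD ?_ hK.integrable hV hW hKVW hVT hWT (hKi _) (hKi _)
  · rwa [integral_map hm.aemeasurable hK.measurable.aestronglyMeasurable,
      integral_map hm.aemeasurable hK.measurable.aestronglyMeasurable] at key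
  · intro c d hcd hd
    rw [hIoc μ, hIoc ν]
    refine hclose _ _ ?_ ?_
    · have := mul_le_mul_of_nonneg_left hcd hh.le
      linarith
    · have := mul_le_mul_of_nonneg_left hd hh.le
      linarith

end HPD

namespace HPD

/-! ### A Bernstein inequality for relative frequencies -/

section Bernstein

variable {𝒳 : Type*} {ι : Type*} [Fintype ι]

/-- The proportion of the points `v i` that lie in `B`. -/
noncomputable def relFreq (v : ι → 𝒳) (B : Set 𝒳) : ℝ :=
  1 / (Fintype.card ι : ℝ) * ∑ i, B.indicator (fun _ => (1 : ℝ)) (v i)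

lemma relFreq_nonneg (v : ι → 𝒳) (B : Set 𝒳) : 0 ≤ relFreq v B :=
  mul_nonneg (by positivity)
    (Finset.sum_nonneg fun _ _ => indicator_nonneg (fun _ _ => zero_le_one) _)

lemma relFreq_mono (v : ι → 𝒳) {A B : Set 𝒳} (h : A ⊆ B) : relFreq v A ≤ relFreq v B := by
  unfold relFreq
  refine mul_le_mul_of_nonneg_left (Finset.sum_le_sum fun i _ => ?_) (by positivity)
  exact indicator_le_indicator_of_subset h (fun _ => zero_le_one) _

lemma relFreq_empty (v : ι → 𝒳) : relFreq v ∅ = 0 := by simp [relFreq]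

variable [MeasurableSpace 𝒳]

lemma measurable_relFreq {B : Set 𝒳} (hB : MeasurableSet B) :
    Measurable fun v : ι → 𝒳 => relFreq v B := by
  unfold relFreq
  refine Measurable.const_mul (Finset.measurable_sum _ fun i _ => ?_) _
  exact (measurable_const.indicator hB).comp (measurable_pi_apply i)

/-- From `1 + x ≤ exp x` and `exp t - 1 - t ≤ t²`. The exponent carries the factor `Q.real B`, which
makes the tail bound sharp for sets of small mass; a Hoeffding bound would lose the factor `h` in
the variance. -/
lemma mgf_centered_indicator_le (Q : Measure 𝒳) [IsProbabilityMeasure Q] {B : Set 𝒳}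
    (hB : MeasurableSet B) {t : ℝ} (ht : |t| ≤ 1) :
    ∫ x, Real.exp (t * (B.indicator (fun _ => (1 : ℝ)) x - Q.real B)) ∂Q
      ≤ Real.exp (Q.real B * t ^ 2) := by
  set p := Q.real B with hp
  have hp0 : 0 ≤ p := measureReal_nonneg
  have hfun : ∀ x, Real.exp (t * (B.indicator (fun _ => (1 : ℝ)) x - p))
      = Real.exp (-(t * p)) * (1 + B.indicator (fun _ => Real.exp t - 1) x) := by
    intro x
    by_cases hx : x ∈ B
    · simp only [indicator_of_mem hx]
      rw [add_sub_cancel, ← Real.exp_add]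
      ring_nf
    · simp only [indicator_of_notMem hx]
      ring_nf
  simp_rw [hfun]
  rw [integral_const_mul, integral_add (integrable_const _)
    ((integrable_const _).indicator hB), integral_indicator_const _ hB]
  simp only [integral_const, probReal_univ, smul_eq_mul, ← hp]
  have h1 : 1 * 1 + p * (Real.exp t - 1) ≤ Real.exp (p * (Real.exp t - 1)) := by
    have := Real.add_one_le_exp (p * (Real.exp t - 1))
    linarith
  calc Real.exp (-(t * p)) * (1 * 1 + p * (Real.exp t - 1))
      ≤ Real.exp (-(t * p)) * Real.exp (p * (Real.exp t - 1)) := by gcongr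
    _ = Real.exp (p * (Real.exp t - 1 - t)) := by rw [← Real.exp_add]; ring_nf
    _ ≤ Real.exp (p * t ^ 2) := by
        gcongr
        exact (le_abs_self _).trans (Real.abs_exp_sub_one_sub_id_le ht)

lemma measureReal_relFreq_le (Q : Measure 𝒳) [IsProbabilityMeasure Q] [Nonempty ι] {B : Set 𝒳}
    (hB : MeasurableSet B) {V s : ℝ} (hBV : Q.real B ≤ V) (hs : 0 < s) (hsV : s ≤ 2 * V) :
    (Measure.pi fun _ : ι => Q).real {v | s ≤ |relFreq v B - Q.real B|}
      ≤ 2 * Real.exp (-(Fintype.card ι * s ^ 2 / (4 * V))) := by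
  set N : ℝ := ((Fintype.card ι : ℕ) : ℝ) with hN
  have hNpos : 0 < N := by rw [hN]; exact_mod_cast Fintype.card_pos
  have hV : 0 < V := by linarith
  set S : (ι → 𝒳) → ℝ := fun v => ∑ i, (B.indicator (fun _ => (1 : ℝ)) (v i) - Q.real B) with hS
  have hSm : Measurable S := by
    refine Finset.measurable_sum _ fun i _ => ?_
    exact ((measurable_const.indicator hB).comp (measurable_pi_apply i)).sub_const _
  have hSb : ∀ v, |S v| ≤ N := by
    intro v
    refine (Finset.abs_sum_le_sum_abs _ _).trans ?_
    have : ∀ i ∈ Finset.univ, |B.indicator (fun _ => (1 : ℝ)) (v i) - Q.real B| ≤ 1 := by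
      intro i _
      have h0 : 0 ≤ Q.real B := measureReal_nonneg
      have h1 : Q.real B ≤ 1 := measureReal_le_one
      by_cases hx : v i ∈ B
      · rw [indicator_of_mem hx, abs_le]; constructor <;> linarith
      · rw [indicator_of_notMem hx, abs_le]; constructor <;> linarith
    refine (Finset.sum_le_sum this).trans_eq ?_
    simp [hN]
  have hint : ∀ t : ℝ, Integrable (fun v => Real.exp (t * S v)) (Measure.pi fun _ : ι => Q) := by
    intro t
    refine Integrable.of_bound (C := Real.exp (|t| * N))
      (Real.measurable_exp.comp (hSm.const_mul t)).aestronglyMeasurable (ae_of_all _ fun v => ?_)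
    rw [Real.norm_eq_abs, Real.abs_exp]
    refine Real.exp_le_exp.2 ((le_abs_self _).trans ?_)
    rw [abs_mul]
    exact mul_le_mul_of_nonneg_left (hSb v) (abs_nonneg t)
  have hmgf : ∀ t : ℝ, |t| ≤ 1 → mgf S (Measure.pi fun _ : ι => Q) t
      ≤ Real.exp (N * (V * t ^ 2)) := by
    intro t ht
    have h1 : mgf S (Measure.pi fun _ : ι => Q) t
        = (∫ x, Real.exp (t * (B.indicator (fun _ => (1 : ℝ)) x - Q.real B)) ∂Q)
          ^ Fintype.card ι := by
      unfold mgf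
      rw [← integral_fintype_prod_eq_pow]
      refine integral_congr_ae (ae_of_all _ fun v => ?_)
      simp only [hS, Finset.mul_sum, Real.exp_sum]
    rw [h1, Real.exp_nat_mul]
    refine pow_le_pow_left₀ (integral_nonneg fun x => (Real.exp_pos _).le) ?_ _
    refine (mgf_centered_indicator_le Q hB ht).trans (Real.exp_le_exp.2 ?_)
    exact mul_le_mul_of_nonneg_right hBV (sq_nonneg t)
  -- The minimizer of `-t N s + N V t²`; the assumption `s ≤ 2 V` is what makes it at most one.
  set t : ℝ := s / (2 * V) with ht
  have ht0 : 0 ≤ t := by positivity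
  have ht1 : |t| ≤ 1 := by
    rw [abs_of_nonneg ht0, ht, div_le_one (by positivity)]
    exact hsV
  have hexp : -t * (N * s) + N * (V * t ^ 2) = -(N * s ^ 2 / (4 * V)) := by
    rw [ht]; field_simp; ring
  have hup : (Measure.pi fun _ : ι => Q).real {v | N * s ≤ S v}
      ≤ Real.exp (-(N * s ^ 2 / (4 * V))) := by
    refine (measure_ge_le_exp_mul_mgf (N * s) ht0 (hint t)).trans ?_
    rw [← hexp, Real.exp_add]
    exact mul_le_mul_of_nonneg_left (hmgf t ht1) (Real.exp_pos _).le
  have hlo : (Measure.pi fun _ : ι => Q).real {v | S v ≤ -(N * s)}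
      ≤ Real.exp (-(N * s ^ 2 / (4 * V))) := by
    refine (measure_le_le_exp_mul_mgf (-(N * s)) (neg_nonpos.2 ht0) (hint (-t))).trans ?_
    rw [← hexp, Real.exp_add]
    have := hmgf (-t) (by rwa [abs_neg])
    rw [neg_sq] at this
    have h2 : - -t * -(N * s) = -t * (N * s) := by ring
    rw [h2]
    exact mul_le_mul_of_nonneg_left this (Real.exp_pos _).le
  have hsub : {v : ι → 𝒳 | s ≤ |relFreq v B - Q.real B|}
      ⊆ {v | N * s ≤ S v} ∪ {v | S v ≤ -(N * s)} := by
    intro v hv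
    have hSv : S v = N * (relFreq v B - Q.real B) := by
      simp only [hS, relFreq, Finset.sum_sub_distrib, Finset.sum_const, Finset.card_univ, ← hN,
        nsmul_eq_mul]
      field_simp
    simp only [mem_ofPred_eq, mem_union] at hv ⊢
    rw [hSv]
    rcases le_abs.1 hv with h | h
    · exact Or.inl (mul_le_mul_of_nonneg_left h hNpos.le)
    · right
      have := mul_le_mul_of_nonneg_left h hNpos.le
      linarith
  refine (measureReal_mono hsub).trans ((measureReal_union_le _ _).trans ?_)
  linarith

/-- The sets are half-lines ending at the `k/n`-quantiles, completed by `∅` and the whole line so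
that the infinite quantiles need no separate treatment. Continuity of the distribution function
makes the masses exact. -/
lemma exists_quantile_grid (μ : Measure ℝ) [IsProbabilityMeasure μ]
    (hcont : Continuous (cdf μ)) {n : ℕ} (hn : 0 < n) :
    ∃ E : ℕ → Set ℝ, (∀ k, MeasurableSet (E k)) ∧ (∀ k ≤ n, μ.real (E k) = k / n) ∧
      Monotone E ∧ ∀ t, ∃ k < n, E k ⊆ Iic t ∧ Iic t ⊆ E (k + 1) := by
  have hn' : (0 : ℝ) < n := by exact_mod_cast hn
  have hq : ∀ k : ℕ, ∃ q : ℝ, 0 < k → k < n → cdf μ q = k / n := by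
    intro k
    by_cases hk : 0 < k ∧ k < n
    · obtain ⟨x, hx⟩ := ((tendsto_cdf_atBot μ).eventually
        (gt_mem_nhds (show (0 : ℝ) < k / n by have := hk.1; positivity))).exists
      obtain ⟨y, hy⟩ := ((tendsto_cdf_atTop μ).eventually
        (lt_mem_nhds (show (k : ℝ) / n < 1 by
          rw [div_lt_one hn']; exact_mod_cast hk.2))).exists
      obtain ⟨q, hq⟩ := mem_range_of_exists_le_of_exists_ge hcont ⟨x, hx.le⟩ ⟨y, hy.le⟩
      exact ⟨q, fun _ _ => hq⟩
    · exact ⟨0, fun h1 h2 => absurd ⟨h1, h2⟩ hk⟩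
  choose q hq using hq
  set E : ℕ → Set ℝ := fun k => if k = 0 then ∅ else if k < n then Iic (q k) else univ with hE
  have hE0 : E 0 = ∅ := by simp [hE]
  have hEk : ∀ k, 0 < k → k < n → E k = Iic (q k) := fun k h1 h2 => by simp [hE, h1.ne', h2]
  have hEn : ∀ k, n ≤ k → E k = univ := fun k h1 => by
    simp [hE, (hn.trans_le h1).ne', not_lt.2 h1]
  refine ⟨E, fun k => ?_, fun k hk => ?_, fun j k hjk => ?_, fun t => ?_⟩
  · rcases Nat.eq_zero_or_pos k with rfl | h0
    · simp [hE0]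
    · rcases lt_or_ge k n with h1 | h1
      · rw [hEk k h0 h1]; exact measurableSet_Iic
      · rw [hEn k h1]; exact MeasurableSet.univ
  · rcases Nat.eq_zero_or_pos k with rfl | h0
    · simp [hE0]
    · rcases lt_or_ge k n with h1 | h1
      · rw [hEk k h0 h1, ← cdf_eq_real, hq k h0 h1]
      · rw [hEn k h1, le_antisymm hk h1, div_self hn'.ne', probReal_univ]
  · rcases Nat.eq_zero_or_pos j with rfl | h0
    · simp [hE0]
    · rcases lt_or_ge k n with h1 | h1
      · rw [hEk k (h0.trans_le hjk) h1, hEk j h0 (hjk.trans_lt h1)]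
        refine Iic_subset_Iic.2 ?_
        rcases hjk.eq_or_lt with rfl | hlt
        · exact le_rfl
        · by_contra! hcon
          have := monotone_cdf μ hcon.le
          rw [hq k (h0.trans_le hjk) h1, hq j h0 (hjk.trans_lt h1),
            div_le_div_iff_of_pos_right hn'] at this
          exact absurd (by exact_mod_cast this) (not_le.2 hlt)
      · rw [hEn k h1]; exact subset_univ _
  · classical
    -- The search stops at `n - 1`, and succeeds because `E 0 = ∅`. When it ends at `n - 1`, the
    -- upper bracket is the whole line.
    set k := Nat.findGreatest (fun k => E k ⊆ Iic t) (n - 1) with hk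
    have hkn : k < n := (Nat.findGreatest_le _).trans_lt (by omega)
    refine ⟨k, hkn, ?_, ?_⟩
    · exact Nat.findGreatest_spec (P := fun k => E k ⊆ Iic t) (Nat.zero_le (n - 1))
        (by simp [hE0])
    · rcases lt_or_ge (k + 1) n with h1 | h1
      · have hnot : ¬ E (k + 1) ⊆ Iic t :=
          Nat.findGreatest_is_greatest (P := fun k => E k ⊆ Iic t) (n := n - 1)
            (Nat.lt_succ_self k) (by omega)
        rw [hEk _ (Nat.succ_pos k) h1] at hnot ⊢
        rw [Iic_subset_Iic] at hnot ⊢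
        exact (not_le.1 hnot).le
      · rw [hEn _ h1]; exact subset_univ _

/-- Bracketing: `E k \ E (j+1) ⊆ (c, d] ⊆ E (k+1) \ E j`, and the masses of the two brackets differ
by `2/n`. The outer bracket must also have mass at most `V`, hence the `2/n` in `hcd`. -/
lemma abs_relFreq_Ioc_sub_le {μ : Measure ℝ} [IsProbabilityMeasure μ] {n : ℕ} (hn : 0 < n)
    {E : ℕ → Set ℝ} (hEm : ∀ k, MeasurableSet (E k)) (hEμ : ∀ k ≤ n, μ.real (E k) = k / n)
    (hE : Monotone E) (hEt : ∀ t, ∃ k < n, E k ⊆ Iic t ∧ Iic t ⊆ E (k + 1))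
    {v : ι → ℝ} {V s : ℝ} (hs : 0 ≤ s)
    (hv : ∀ j k, j < k → k ≤ n → μ.real (E k \ E j) ≤ V →
      |relFreq v (E k \ E j) - μ.real (E k \ E j)| ≤ s)
    {c d : ℝ} (hcd : μ.real (Ioc c d) + 2 / n ≤ V) :
    |relFreq v (Ioc c d) - μ.real (Ioc c d)| ≤ s + 2 / n := by
  have hn' : (0 : ℝ) < n := by exact_mod_cast hn
  obtain ⟨j, hjn, hj1, hj2⟩ := hEt c
  obtain ⟨k, hkn, hk1, hk2⟩ := hEt d
  have hdiff : ∀ j k : ℕ, j ≤ k → k ≤ n → μ.real (E k \ E j) = ((k : ℝ) - j) / n := by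
    intro j k hjk hkn
    rw [measureReal_sdiff (hE hjk) (hEm j), hEμ k hkn, hEμ j (hjk.trans hkn), sub_div]
  have hsub1 : Ioc c d ⊆ E (k + 1) \ E j := fun x hx =>
    ⟨hk2 hx.2, fun hxj => absurd (hj1 hxj) (not_le.2 hx.1)⟩
  have hsub2 : E k \ E (j + 1) ⊆ Ioc c d := fun x hx =>
    ⟨not_le.1 fun hxc => hx.2 (hj2 hxc), hk1 hx.1⟩
  have h2n : (0 : ℝ) < 2 / n := by positivity
  rcases Nat.lt_or_ge k j with hkj | hjk
  · have : Ioc c d = ∅ := by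
      refine subset_eq_empty hsub1 ?_
      exact sdiff_eq_empty.2 (hE hkj)
    rw [this, relFreq_empty, measureReal_empty]
    simp only [sub_self, abs_zero]
    positivity
  have hlow : ((k : ℝ) - j - 1) / n ≤ μ.real (Ioc c d) := by
    rcases Nat.lt_or_ge j k with h | h
    · have := hdiff (j + 1) k h hkn.le
      push_cast at this
      rw [sub_sub, ← this]
      exact measureReal_mono hsub2
    · have h0 : (k : ℝ) ≤ j := by exact_mod_cast h
      have h3 : ((k : ℝ) - j - 1) / n ≤ 0 := div_nonpos_of_nonpos_of_nonneg (by linarith) hn'.le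
      exact h3.trans measureReal_nonneg
  have hupμ := hdiff j (k + 1) (by omega) hkn
  have hupm : μ.real (Ioc c d) ≤ ((k : ℝ) - j + 1) / n := by
    have := measureReal_mono (μ := μ) hsub1
    rw [hupμ] at this
    push_cast at this
    rwa [show ((k : ℝ) - j + 1) = k + 1 - j by ring]
  have hgap : ((k : ℝ) - j + 1) / n = ((k : ℝ) - j - 1) / n + 2 / n := by ring
  rw [abs_le]
  constructor
  · rcases Nat.lt_or_ge (j + 1) k with h | h
    · have heq := hdiff (j + 1) k h.le hkn.le
      have hb := hv (j + 1) k h hkn.le ((measureReal_mono hsub2).trans (by linarith))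
      have hm := relFreq_mono v hsub2
      push_cast at heq
      rw [← sub_sub] at heq
      rw [heq, abs_le] at hb
      linarith [hb.1]
    · have h0 : (k : ℝ) ≤ j + 1 := by exact_mod_cast h
      have h3 : ((k : ℝ) - j - 1) / n ≤ 0 := div_nonpos_of_nonpos_of_nonneg (by linarith) hn'.le
      have := relFreq_nonneg v (Ioc c d)
      linarith
  · have hb := hv j (k + 1) (by omega) hkn (by
      rw [hupμ]; push_cast
      rw [show ((k : ℝ) + 1 - j) = k - j + 1 by ring, hgap]; linarith)
    have hm := relFreq_mono v hsub1
    rw [hupμ] at hb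
    push_cast at hb
    rw [show ((k : ℝ) + 1 - j) = k - j + 1 by ring, abs_le] at hb
    linarith [hb.2]

lemma continuous_cdf_of_measureReal_Ioc_le {μ : Measure ℝ} [IsProbabilityMeasure μ] {M : ℝ}
    (hM : ∀ c d, c ≤ d → μ.real (Ioc c d) ≤ M * (d - c)) : Continuous (cdf μ) := by
  have hle : ∀ c d, c ≤ d → cdf μ d - cdf μ c ≤ M * (d - c) := by
    intro c d hcd
    rw [cdf_eq_real, cdf_eq_real, ← measureReal_sdiff (Iic_subset_Iic.2 hcd) measurableSet_Iic,
      Iic_sdiff_Iic]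
    exact hM c d hcd
  have hM0 : 0 ≤ M := by simpa using measureReal_nonneg.trans (hM 0 1 zero_le_one)
  refine (LipschitzWith.of_dist_le_mul (K := M.toNNReal) fun x y => ?_).continuous
  rw [Real.coe_toNNReal _ hM0, Real.dist_eq, Real.dist_eq]
  rcases le_total x y with h | h
  · have := monotone_cdf μ h
    rw [abs_sub_comm, abs_sub_comm x, abs_of_nonneg (by linarith), abs_of_nonneg (by linarith)]
    exact hle _ _ h
  · have := monotone_cdf μ h
    rw [abs_of_nonneg (by linarith), abs_of_nonneg (by linarith)]
    exact hle _ _ h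

/-- Uniform concentration of relative frequencies over all intervals of length at most `w`. -/
lemma measureReal_exists_Ioc_deviation_le (Q : Measure 𝒳) [IsProbabilityMeasure Q] [Nonempty ι]
    {φ : 𝒳 → ℝ} (hφ : Measurable φ) {M w V s : ℝ}
    (hM : ∀ c d, c ≤ d → (Q.map φ).real (Ioc c d) ≤ M * (d - c))
    (hV : M * w + 2 / Fintype.card ι ≤ V) (hs : 0 < s) (hsV : s ≤ 2 * V) :
    (Measure.pi fun _ : ι => Q).real {v | ∃ c d, c ≤ d ∧ d ≤ c + w ∧
        s + 2 / Fintype.card ι < |relFreq (fun i => φ (v i)) (Ioc c d) - (Q.map φ).real (Ioc c d)|}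
      ≤ (Fintype.card ι + 1) ^ 2 * (2 * Real.exp (-(Fintype.card ι * s ^ 2 / (4 * V)))) := by
  have hμ : IsProbabilityMeasure (Q.map φ) := Measure.isProbabilityMeasure_map hφ.aemeasurable
  set n := Fintype.card ι with hn
  have hn0 : 0 < n := Fintype.card_pos
  obtain ⟨E, hEm, hEμ, hE, hEt⟩ :=
    exists_quantile_grid (Q.map φ) (continuous_cdf_of_measureReal_Ioc_le hM) hn0
  -- At most `(n + 1)²` grid differences enter the union bound, all of mass at most `V`, the
  -- variance proxy in Bernstein's inequality.
  set I := (Finset.range (n + 1) ×ˢ Finset.range (n + 1)).filter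
    fun p => (Q.map φ).real (E p.2 \ E p.1) ≤ V with hI
  have hM0 : 0 ≤ M := by simpa using measureReal_nonneg.trans (hM 0 1 zero_le_one)
  have hrel : ∀ (v : ι → 𝒳) (B : Set ℝ), relFreq (fun i => φ (v i)) B = relFreq v (φ ⁻¹' B) := by
    intro v B
    rfl
  have hsub : {v : ι → 𝒳 | ∃ c d, c ≤ d ∧ d ≤ c + w ∧
        s + 2 / n < |relFreq (fun i => φ (v i)) (Ioc c d) - (Q.map φ).real (Ioc c d)|}
      ⊆ ⋃ p ∈ I, {v | s ≤ |relFreq v (φ ⁻¹' (E p.2 \ E p.1)) - Q.real (φ ⁻¹' (E p.2 \ E p.1))|} := by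
    rintro v ⟨c, d, hcd, hdw, hlt⟩
    by_contra hcon
    simp only [mem_iUnion, mem_ofPred_eq, not_exists, not_le] at hcon
    refine absurd hlt (not_lt.2 (abs_relFreq_Ioc_sub_le hn0 hEm hEμ hE hEt hs.le ?_ ?_ (V := V)))
    · intro j k hjk hkn hVle
      rw [hrel, map_measureReal_apply hφ ((hEm k).diff (hEm j))]
      refine (hcon (j, k) ?_).le
      simp only [hI, Finset.mem_filter, Finset.mem_product, Finset.mem_range]
      exact ⟨⟨by omega, by omega⟩, hVle⟩
    · have h1 := hM c d hcd
      have h2 : M * (d - c) ≤ M * w := mul_le_mul_of_nonneg_left (by linarith) hM0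
      linarith
  refine (measureReal_mono hsub (measure_ne_top _ _)).trans
    ((measureReal_biUnion_finset_le _ _).trans ?_)
  have hterm : ∀ p ∈ I, (Measure.pi fun _ : ι => Q).real
      {v | s ≤ |relFreq v (φ ⁻¹' (E p.2 \ E p.1)) - Q.real (φ ⁻¹' (E p.2 \ E p.1))|}
      ≤ 2 * Real.exp (-(n * s ^ 2 / (4 * V))) := by
    intro p hp
    refine measureReal_relFreq_le Q (hφ ((hEm _).diff (hEm _))) ?_ hs hsV
    rw [← map_measureReal_apply hφ ((hEm _).diff (hEm _))]
    exact (Finset.mem_filter.1 hp).2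
  refine (Finset.sum_le_sum hterm).trans ?_
  rw [Finset.sum_const, nsmul_eq_mul]
  refine mul_le_mul_of_nonneg_right ?_ (by positivity)
  have hc : I.card ≤ (n + 1) ^ 2 := by
    refine (Finset.card_filter_le _ _).trans_eq ?_
    simp [sq]
  exact_mod_cast hc

end Bernstein

end HPD

namespace HPD

/-! ### Short intervals with rational end points -/

lemma exists_rat_seq_tendsto_right (x : ℝ) :
    ∃ u : ℕ → ℚ, (∀ k, x < u k) ∧ Tendsto (fun k => (u k : ℝ)) atTop (𝓝[≥] x) := by
  obtain ⟨u, -, hu, hlim⟩ :=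
    (Rat.isDenseEmbedding_coe_real.dense).exists_seq_strictAnti_tendsto Rat.cast_mono x
  exact ⟨u, hu, tendsto_nhdsWithin_iff.2 ⟨hlim, Eventually.of_forall fun k => mem_Ici.2 (le_of_lt (hu k))⟩⟩

lemma measureReal_Ioc_eq_cdf (μ : Measure ℝ) [IsProbabilityMeasure μ] {c d : ℝ} (hcd : c ≤ d) :
    μ.real (Ioc c d) = cdf μ d - cdf μ c := by
  rw [cdf_eq_real, cdf_eq_real, ← measureReal_sdiff (Iic_subset_Iic.2 hcd) measurableSet_Iic,
    Iic_sdiff_Iic]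

lemma tendsto_measureReal_Ioc (μ : Measure ℝ) [IsProbabilityMeasure μ] {c d : ℝ} (hcd : c ≤ d)
    {u w : ℕ → ℝ} (hu : Tendsto u atTop (𝓝[≥] c)) (hw : Tendsto w atTop (𝓝[≥] d))
    (huw : ∀ᶠ k in atTop, u k ≤ w k) :
    Tendsto (fun k => μ.real (Ioc (u k) (w k))) atTop (𝓝 (μ.real (Ioc c d))) := by
  rw [measureReal_Ioc_eq_cdf μ hcd]
  refine Tendsto.congr' ?_ ((((cdf μ).right_continuous d).tendsto.comp hw).sub
    (((cdf μ).right_continuous c).tendsto.comp hu))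
  filter_upwards [huw] with k hk
  exact (measureReal_Ioc_eq_cdf μ hk).symm

/-- Both end points are approached from the right, where distribution functions are continuous. The
approximating intervals may be slightly longer than `h`, which the bound `2 * h` absorbs. -/
lemma abs_measureReal_Ioc_sub_le_of_rat {μ ν : Measure ℝ} [IsProbabilityMeasure μ]
    [IsProbabilityMeasure ν] {h D : ℝ} (hh : 0 < h)
    (hr : ∀ c d : ℚ, (c : ℝ) ≤ d → (d : ℝ) ≤ c + 2 * h →
      |μ.real (Ioc (c : ℝ) d) - ν.real (Ioc (c : ℝ) d)| ≤ D)
    {c d : ℝ} (hcd : c ≤ d) (hd : d ≤ c + h) :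
    |μ.real (Ioc c d) - ν.real (Ioc c d)| ≤ D := by
  rcases hcd.eq_or_lt with rfl | hlt
  · have := hr 0 0 le_rfl (by linarith)
    simpa using this
  obtain ⟨u, hu, hul⟩ := exists_rat_seq_tendsto_right c
  obtain ⟨w, hw, hwl⟩ := exists_rat_seq_tendsto_right d
  have h1 : ∀ᶠ k in atTop, (u k : ℝ) < d :=
    (tendsto_nhdsWithin_iff.1 hul).1.eventually (gt_mem_nhds hlt)
  have h2 : ∀ᶠ k in atTop, (w k : ℝ) < d + h :=
    (tendsto_nhdsWithin_iff.1 hwl).1.eventually (gt_mem_nhds (by linarith))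
  have huw : ∀ᶠ k in atTop, (u k : ℝ) ≤ w k := by
    filter_upwards [h1] with k hk
    exact (hk.trans (hw k)).le
  refine le_of_tendsto ((tendsto_measureReal_Ioc μ hcd hul hwl huw).sub
    (tendsto_measureReal_Ioc ν hcd hul hwl huw)).abs ?_
  filter_upwards [huw, h2] with k hk hk2
  exact hr _ _ hk (by linarith [hu k])

lemma measureReal_Ioc_le_of_rat {μ : Measure ℝ} [IsProbabilityMeasure μ] {M : ℝ}
    (hr : ∀ c d : ℚ, (c : ℝ) ≤ d → μ.real (Ioc (c : ℝ) d) ≤ M * (d - c))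
    {c d : ℝ} (hcd : c ≤ d) : μ.real (Ioc c d) ≤ M * (d - c) := by
  rcases hcd.eq_or_lt with rfl | hlt
  · simp
  obtain ⟨u, hu, hul⟩ := exists_rat_seq_tendsto_right c
  obtain ⟨w, hw, hwl⟩ := exists_rat_seq_tendsto_right d
  have h1 : ∀ᶠ k in atTop, (u k : ℝ) < d :=
    (tendsto_nhdsWithin_iff.1 hul).1.eventually (gt_mem_nhds hlt)
  have huw : ∀ᶠ k in atTop, (u k : ℝ) ≤ w k := by
    filter_upwards [h1] with k hk
    exact (hk.trans (hw k)).le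
  refine le_of_tendsto_of_tendsto (tendsto_measureReal_Ioc μ hcd hul hwl huw)
    (((tendsto_nhdsWithin_iff.1 hwl).1.sub (tendsto_nhdsWithin_iff.1 hul).1).const_mul M) ?_
  filter_upwards [huw] with k hk
  exact hr _ _ hk

/-! ### The empirical measure -/

/-- The empirical measure of the points `v i`. -/
noncomputable def empMeasure {ι : Type*} [Fintype ι] (v : ι → ℝ) : Measure ℝ :=
  (Fintype.card ι : ℝ≥0∞)⁻¹ • ∑ i, Measure.dirac (v i)

section Empirical

variable {ι : Type*} [Fintype ι]

instance [Nonempty ι] (v : ι → ℝ) : IsProbabilityMeasure (empMeasure v) := by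
  constructor
  simp only [empMeasure, Measure.smul_apply, Measure.finsetSum_apply, measure_univ,
    Finset.sum_const, Finset.card_univ, nsmul_eq_mul, mul_one, smul_eq_mul]
  refine ENNReal.inv_mul_cancel ?_ (ENNReal.natCast_ne_top _)
  exact_mod_cast Fintype.card_ne_zero

lemma integral_empMeasure (v : ι → ℝ) (ψ : ℝ → ℝ) :
    ∫ w, ψ w ∂(empMeasure v) = 1 / (Fintype.card ι : ℝ) * ∑ i, ψ (v i) := by
  rw [empMeasure, integral_smul_measure, integral_finsetSum_measure]
  · simp
  · intro i _
    exact integrable_dirac (by simp)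

lemma empMeasure_real (v : ι → ℝ) {B : Set ℝ} (hB : MeasurableSet B) :
    (empMeasure v).real B = relFreq v B := by
  have h := integral_empMeasure v (B.indicator fun _ => (1 : ℝ))
  rw [integral_indicator_const _ hB] at h
  simpa [relFreq] using h

end Empirical

/-! ### Conditional concentration given the training data -/

section Conditional

variable {Ω Θ 𝒳 : Type*} [MeasurableSpace Ω] [MeasurableSpace Θ] [MeasurableSpace 𝒳]
  {ι : Type*} [Fintype ι]

/-- The pairs `(θ, v)` such that the law of `φ (θ, ·)` has a density bounded by `M`, but deviates
from the empirical measure by more than `η` on a rational interval of length at most `w`. -/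
def deviationSet (κ : Measure 𝒳) (φ : Θ × 𝒳 → ℝ) (M w η : ℝ) : Set (Θ × (ι → 𝒳)) :=
  {p | (∀ c d : ℚ, (c : ℝ) ≤ d →
      (κ.map fun x => φ (p.1, x)).real (Ioc (c : ℝ) d) ≤ M * (d - c)) ∧
    ∃ c d : ℚ, (c : ℝ) ≤ d ∧ (d : ℝ) ≤ c + w ∧
      η < |relFreq (fun i => φ (p.1, p.2 i)) (Ioc (c : ℝ) d)
        - (κ.map fun x => φ (p.1, x)).real (Ioc (c : ℝ) d)|}

lemma measurable_map_section_real (κ : Measure 𝒳) [IsProbabilityMeasure κ] {φ : Θ × 𝒳 → ℝ}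
    (hφ : Measurable φ) (c d : ℝ) :
    Measurable fun θ => (κ.map fun x => φ (θ, x)).real (Ioc c d) := by
  have h := (measurable_measure_prodMk_left (ν := κ) (hφ (measurableSet_Ioc (a := c) (b := d))))
  convert h.ennreal_toReal using 2 with θ
  exact map_measureReal_apply (hφ.comp measurable_prodMk_left) measurableSet_Ioc

/-- Rational end points make the union and intersection countable. -/
lemma measurableSet_deviationSet (κ : Measure 𝒳) [IsProbabilityMeasure κ] {φ : Θ × 𝒳 → ℝ}
    (hφ : Measurable φ) (M w η : ℝ) :
    MeasurableSet (deviationSet (ι := ι) κ φ M w η) := by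
  have h1 : ∀ c d : ℝ, Measurable fun p : Θ × (ι → 𝒳) =>
      (κ.map fun x => φ (p.1, x)).real (Ioc c d) :=
    fun c d => (measurable_map_section_real κ hφ c d).comp measurable_fst
  have h2 : ∀ c d : ℝ, Measurable fun p : Θ × (ι → 𝒳) =>
      relFreq (fun i => φ (p.1, p.2 i)) (Ioc c d) := by
    intro c d
    refine (measurable_relFreq measurableSet_Ioc).comp (measurable_pi_lambda _ fun i => ?_)
    exact hφ.comp (measurable_fst.prodMk ((measurable_pi_apply i).comp measurable_snd))
  have h3 : deviationSet (ι := ι) κ φ M w η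
      = (⋂ (c : ℚ) (d : ℚ) (_ : (c : ℝ) ≤ d), {p | (κ.map fun x => φ (p.1, x)).real (Ioc (c : ℝ) d)
          ≤ M * (d - c)}) ∩
        ⋃ (c : ℚ) (d : ℚ) (_ : (c : ℝ) ≤ d) (_ : (d : ℝ) ≤ c + w),
          {p | η < |relFreq (fun i => φ (p.1, p.2 i)) (Ioc (c : ℝ) d)
            - (κ.map fun x => φ (p.1, x)).real (Ioc (c : ℝ) d)|} := by
    ext p
    simp only [deviationSet, mem_inter_iff, mem_iInter, mem_iUnion, mem_ofPred_eq, exists_prop]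
  rw [h3]
  refine MeasurableSet.inter ?_ ?_
  · exact MeasurableSet.iInter fun c => MeasurableSet.iInter fun d => MeasurableSet.iInter fun _ =>
      measurableSet_le (h1 c d) measurable_const
  · exact MeasurableSet.iUnion fun c => MeasurableSet.iUnion fun d => MeasurableSet.iUnion fun _ =>
      MeasurableSet.iUnion fun _ =>
        measurableSet_lt measurable_const ((h2 c d).sub (h1 c d)).abs

/-- By independence the joint law is a product, so by Tonelli it suffices to bound each slice at
fixed `θ`. If the law of `φ (θ, ·)` satisfies the interval bound with `M`, the slice obeys the
i.i.d. bound; otherwise it is empty. No condition on `θ` is therefore needed. -/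
lemma measureReal_deviationSet_le (P : Measure Ω) [IsProbabilityMeasure P] {T : Ω → Θ}
    {Z : Ω → ι → 𝒳} (hT : Measurable T) (hZ : Measurable Z) (hTZ : IndepFun T Z P)
    (κ : Measure 𝒳) [IsProbabilityMeasure κ] (hlaw : P.map Z = Measure.pi fun _ => κ)
    [Nonempty ι] {φ : Θ × 𝒳 → ℝ} (hφ : Measurable φ) {M w V s : ℝ}
    (hV : M * w + 2 / Fintype.card ι ≤ V) (hs : 0 < s) (hsV : s ≤ 2 * V) :
    P.real {ω | (T ω, Z ω) ∈ deviationSet κ φ M w (s + 2 / Fintype.card ι)}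
      ≤ (Fintype.card ι + 1) ^ 2 * (2 * Real.exp (-(Fintype.card ι * s ^ 2 / (4 * V)))) := by
  set B := deviationSet (ι := ι) κ φ M w (s + 2 / Fintype.card ι) with hB
  have hBm : MeasurableSet B := measurableSet_deviationSet κ hφ _ _ _
  set p := (Fintype.card ι + 1 : ℝ) ^ 2 * (2 * Real.exp (-(Fintype.card ι * s ^ 2 / (4 * V)))) with hp
  have hp0 : 0 ≤ p := by positivity
  have hPT : IsProbabilityMeasure (P.map T) := Measure.isProbabilityMeasure_map hT.aemeasurable
  have hprod := (indepFun_iff_map_prod_eq_prod_map_map hT.aemeasurable hZ.aemeasurable).1 hTZ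
  have h1 : P {ω | (T ω, Z ω) ∈ B} = ((P.map T).prod (Measure.pi fun _ => κ)) B := by
    rw [← hlaw, ← hprod, Measure.map_apply (hT.prodMk hZ) hBm]
    rfl
  have hslice : ∀ θ, (Measure.pi fun _ : ι => κ) (Prod.mk θ ⁻¹' B) ≤ ENNReal.ofReal p := by
    intro θ
    have hφθ : Measurable fun x => φ (θ, x) := hφ.comp measurable_prodMk_left
    by_cases hD : ∀ c d : ℚ, (c : ℝ) ≤ d →
      (κ.map fun x => φ (θ, x)).real (Ioc (c : ℝ) d) ≤ M * (d - c)
    · have := Measure.isProbabilityMeasure_map (μ := κ) hφθ.aemeasurable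
      have hb := measureReal_exists_Ioc_deviation_le (ι := ι) κ hφθ
        (fun c d hcd => measureReal_Ioc_le_of_rat hD hcd) hV hs hsV
      rw [← ofReal_measureReal]
      refine ENNReal.ofReal_le_ofReal (le_trans (measureReal_mono ?_) hb)
      rintro v ⟨-, c, d, hcd, hdw, hlt⟩
      exact ⟨c, d, hcd, hdw, hlt⟩
    · have : Prod.mk θ ⁻¹' B = ∅ := by
        ext v
        simp only [mem_preimage, mem_empty_iff_false, iff_false]
        exact fun hv => hD hv.1
      simp [this]
  have h2 : P {ω | (T ω, Z ω) ∈ B} ≤ ENNReal.ofReal p := by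
    rw [h1, Measure.prod_apply hBm]
    refine (lintegral_mono hslice).trans ?_
    simp
  exact ENNReal.toReal_le_of_le_ofReal hp0 h2

end Conditional

end HPD

namespace HPD

/-! ### Smoothing a density after a change of location and scale -/

section Smoothing

/-- The substitution `u = (a + b e - z) / h`; the right side is a kernel average of the density of
`a + b ε`. -/
lemma integral_kernel_affine (K f : ℝ → ℝ) {a b h z : ℝ} (hb : 0 < b) (hh : 0 < h) :
    ∫ e, K ((a + b * e - z) / h) * f e
      = h * ∫ u, K u * (b⁻¹ * f (b⁻¹ * (z + h * u - a))) := by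
  set G : ℝ → ℝ := fun u => K u * f (b⁻¹ * (z + h * u - a)) with hG
  have h1 : ∀ e, K ((a + b * e - z) / h) * f e = (fun u => G (u + (a - z) / h)) (b / h * e) := by
    intro e
    simp only [hG]
    congr 2
    · field_simp; ring
    · field_simp; ring
  simp_rw [h1]
  rw [Measure.integral_comp_mul_left (fun u => G (u + (a - z) / h)),
    integral_add_right_eq_self G, abs_of_pos (by positivity), inv_div, smul_eq_mul]
  have h2 : ∀ u, K u * (b⁻¹ * f (b⁻¹ * (z + h * u - a))) = b⁻¹ * G u := fun u => by
    simp only [hG]; ring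
  simp_rw [h2, integral_const_mul]
  field_simp

variable {K f : ℝ → ℝ} {a b h z M L r ρ : ℝ}

lemma integrable_kernel_mul (hK : KernelAssumption K) (hfm : Measurable f)
    (hM : ∀ z, |f z| ≤ M) :
    Integrable fun u => K u * (b⁻¹ * f (b⁻¹ * (z + h * u - a))) := by
  refine hK.integrable.mul_bdd (c := |b⁻¹| * M) ?_ (ae_of_all _ fun u => ?_)
  · refine Measurable.aestronglyMeasurable ?_
    exact (hfm.comp (by fun_prop)).const_mul _
  · rw [Real.norm_eq_abs, abs_mul]
    exact mul_le_mul_of_nonneg_left (hM _) (abs_nonneg _)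

/-- The three error terms come from the change of scale, the shift and the smoothing. The first
grows with `|z|`, so the bound is useful on bounded sets only. -/
lemma abs_integral_kernel_affine_sub_le (hK : KernelAssumption K) (hfm : Measurable f)
    (hM : ∀ z, |f z| ≤ M) (hL : ∀ z z', |f z - f z'| ≤ L * |z - z'|)
    (hb : 0 < b) (hh : 0 < h) (hr : r ≤ 1) (hbr : |b⁻¹ - 1| ≤ r) (hρ : |a| ≤ ρ) :
    |(∫ e, K ((a + b * e - z) / h) * f e) - h * f z|
      ≤ h * (r * (M + L * |z|) + 2 * L * ρ + 2 * L * h * ∫ u, |u| * K u) := by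
  have hM0 : 0 ≤ M := (abs_nonneg _).trans (hM 0)
  have hL0 : 0 ≤ L := by
    have := (abs_nonneg _).trans (hL 1 0)
    simpa using this
  have hr0 : 0 ≤ r := (abs_nonneg _).trans hbr
  have hb2 : b⁻¹ ≤ 2 := by linarith [(abs_le.1 hbr).2]
  have hb0 : 0 < b⁻¹ := inv_pos.2 hb
  have hpt : ∀ u, |b⁻¹ * f (b⁻¹ * (z + h * u - a)) - f z|
      ≤ (r * (M + L * |z|) + 2 * L * ρ) + 2 * L * h * |u| := by
    intro u
    set w := b⁻¹ * (z + h * u - a) with hw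
    have e1 : b⁻¹ * f w - f z = (b⁻¹ - 1) * f w + (f w - f z) := by ring
    have e2 : |(b⁻¹ - 1) * f w| ≤ r * M := by
      rw [abs_mul]
      exact mul_le_mul hbr (hM _) (abs_nonneg _) hr0
    have e3 : |w - z| ≤ r * |z| + 2 * (h * |u|) + 2 * ρ := by
      have : w - z = (b⁻¹ - 1) * z + b⁻¹ * (h * u) + b⁻¹ * (-a) := by rw [hw]; ring
      rw [this]
      refine (abs_add_three _ _ _).trans ?_
      rw [abs_mul, abs_mul, abs_mul, abs_mul, abs_neg, abs_of_pos hb0, abs_of_pos hh]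
      gcongr
    have e4 := (hL w z).trans (mul_le_mul_of_nonneg_left e3 hL0)
    rw [e1]
    refine (abs_add_le _ _).trans ?_
    linarith
  rw [integral_kernel_affine K f hb hh]
  have h1 : h * (∫ u, K u * (b⁻¹ * f (b⁻¹ * (z + h * u - a)))) - h * f z
      = h * ∫ u, K u * (b⁻¹ * f (b⁻¹ * (z + h * u - a)) - f z) := by
    have hz : f z = ∫ u, K u * f z := by rw [integral_mul_const, hK.integral_eq_one, one_mul]
    simp_rw [mul_sub (K _)]
    rw [integral_sub (integrable_kernel_mul hK hfm hM) (hK.integrable.mul_const _), ← hz, mul_sub]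
  rw [h1, abs_mul, abs_of_pos hh]
  refine mul_le_mul_of_nonneg_left ?_ hh.le
  have hint : Integrable fun u => (r * (M + L * |z|) + 2 * L * ρ) * K u
      + 2 * L * h * (|u| * K u) :=
    (hK.integrable.const_mul _).add (hK.integrable_abs_mul.const_mul _)
  rw [← Real.norm_eq_abs]
  refine (norm_integral_le_of_norm_le hint (ae_of_all _ fun u => ?_)).trans_eq ?_
  · rw [Real.norm_eq_abs, abs_mul, abs_of_nonneg (hK.nonneg u)]
    refine (mul_le_mul_of_nonneg_left (hpt u) (hK.nonneg u)).trans_eq ?_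
    ring
  · rw [integral_add (hK.integrable.const_mul _) (hK.integrable_abs_mul.const_mul _),
      integral_const_mul, integral_const_mul, hK.integral_eq_one, mul_one]

/-- If `h |u| ≤ R`, then `|z + h u - a| > 4R - R - R`, and after multiplication by `b⁻¹ ≥ 1/2` the
argument of `f` still exceeds `R`. If `h |u| > R`, the crude bound `2M` is paid for by the factor `h
|u| / R > 1`. -/
lemma integral_kernel_affine_le_of_far (hK : KernelAssumption K) (hfm : Measurable f)
    (hM : ∀ z, |f z| ≤ M) {R t : ℝ} (hR : 0 < R) (ht : 0 ≤ t)
    (hft : ∀ z, R < |z| → f z ≤ t)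
    (hb : 0 < b) (hh : 0 < h) (hr : r ≤ 1 / 2) (hbr : |b⁻¹ - 1| ≤ r) (hρ : |a| ≤ R)
    (hz : 4 * R < |z|) :
    ∫ e, K ((a + b * e - z) / h) * f e ≤ h * (t + r * t + 2 * M / R * h * ∫ u, |u| * K u) := by
  have hM0 : 0 ≤ M := (abs_nonneg _).trans (hM 0)
  have hr0 : 0 ≤ r := (abs_nonneg _).trans hbr
  have hb1 : b⁻¹ ≤ 1 + r := by linarith [(abs_le.1 hbr).2]
  have hb2 : 1 / 2 ≤ b⁻¹ := by linarith [(abs_le.1 hbr).1]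
  have hb0 : 0 < b⁻¹ := inv_pos.2 hb
  have hpt : ∀ u, b⁻¹ * f (b⁻¹ * (z + h * u - a)) ≤ (t + r * t) + 2 * M / R * h * |u| := by
    intro u
    have hn : 0 ≤ 2 * M / R * h * |u| := by positivity
    rcases le_or_gt (h * |u|) R with hu | hu
    · have h1 : 2 * R < |z + h * u - a| := by
        have h2 : |z| ≤ |z + h * u - a| + |h * u| + |a| := by
          have := abs_add_three (z + h * u - a) (-(h * u)) a
          rw [abs_neg] at this
          refine le_trans (le_of_eq ?_) this
          congr 1; ring
        rw [abs_mul h, abs_of_pos hh] at h2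
        linarith
      have h3 : R < |b⁻¹ * (z + h * u - a)| := by
        rw [abs_mul, abs_of_pos hb0]
        nlinarith
      have h4 := hft _ h3
      calc b⁻¹ * f (b⁻¹ * (z + h * u - a)) ≤ b⁻¹ * t := by gcongr
        _ ≤ (1 + r) * t := by gcongr
        _ ≤ _ := by linarith
    · have h4 : f (b⁻¹ * (z + h * u - a)) ≤ M := (le_abs_self _).trans (hM _)
      calc b⁻¹ * f (b⁻¹ * (z + h * u - a)) ≤ b⁻¹ * M := by gcongr
        _ ≤ 2 * M := by gcongr; linarith
        _ ≤ 2 * M * (h * |u| / R) :=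
            le_mul_of_one_le_right (by positivity) ((one_le_div hR).2 hu.le)
        _ = 2 * M / R * h * |u| := by ring
        _ ≤ _ := by
          have : 0 ≤ t + r * t := by positivity
          linarith
  rw [integral_kernel_affine K f hb hh]
  refine mul_le_mul_of_nonneg_left ?_ hh.le
  have hint : Integrable fun u => (t + r * t) * K u + 2 * M / R * h * (|u| * K u) :=
    (hK.integrable.const_mul _).add (hK.integrable_abs_mul.const_mul _)
  refine (integral_mono (integrable_kernel_mul hK hfm hM) hint fun u => ?_).trans_eq ?_
  · refine (mul_le_mul_of_nonneg_left (hpt u) (hK.nonneg u)).trans_eq ?_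
    ring
  · rw [integral_add (hK.integrable.const_mul _) (hK.integrable_abs_mul.const_mul _),
      integral_const_mul, integral_const_mul, hK.integral_eq_one, mul_one]

lemma integral_indicator_affine_le (hM : ∀ z, |f z| ≤ M) {c d : ℝ} (hcd : c ≤ d)
    (hb : 0 < b) (hb2 : b⁻¹ ≤ 2) :
    ∫ e, (Ioc c d).indicator (fun _ => (1 : ℝ)) (a + b * e) * f e ≤ 2 * M * (d - c) := by
  have hM0 : 0 ≤ M := (abs_nonneg _).trans (hM 0)
  have h1 : ∀ e, (Ioc c d).indicator (fun _ => (1 : ℝ)) (a + b * e) * f e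
      = (Ioc ((c - a) / b) ((d - a) / b)).indicator f e := by
    intro e
    have : a + b * e ∈ Ioc c d ↔ e ∈ Ioc ((c - a) / b) ((d - a) / b) := by
      simp only [mem_Ioc, div_lt_iff₀ hb, le_div_iff₀ hb]
      constructor <;> rintro ⟨h1, h2⟩ <;> constructor <;> linarith
    by_cases he : a + b * e ∈ Ioc c d
    · rw [indicator_of_mem he, indicator_of_mem (this.1 he), one_mul]
    · rw [indicator_of_notMem he, indicator_of_notMem (fun h => he (this.2 h)), zero_mul]
  simp_rw [h1]
  rw [integral_indicator measurableSet_Ioc]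
  have h2 := norm_setIntegral_le_of_norm_le_const (μ := volume)
    (s := Ioc ((c - a) / b) ((d - a) / b)) (C := M) (f := f) (by simp) (fun z _ => hM z)
  have h3 : (c - a) / b ≤ (d - a) / b := by gcongr
  rw [Real.volume_real_Ioc_of_le h3] at h2
  refine (le_abs_self _).trans (h2.trans ?_)
  have h4 : (d - a) / b - (c - a) / b = b⁻¹ * (d - c) := by field_simp; ring
  rw [h4]
  have : b⁻¹ * (d - c) ≤ 2 * (d - c) := mul_le_mul_of_nonneg_right hb2 (by linarith)
  nlinarith

end Smoothing

/-! ### The law of a residual for a fixed fit -/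

section ResidualLaw

variable {Ω : Type*} [MeasurableSpace Ω] {P : Measure Ω} {d : ℕ}
  {X : ℕ → Ω → Cov d} {Y : ℕ → Ω → ℝ} {g σ : Cov d → ℝ} {f : ℝ → ℝ}

/-- The law of `(Y - gh X) / sh X` for fixed functions `gh`, `sh`. -/
noncomputable def residualLaw (P : Measure Ω) (X : ℕ → Ω → Cov d) (Y : ℕ → Ω → ℝ)
    (gh sh : Cov d → ℝ) : Measure ℝ :=
  (P.map fun ω => (X 0 ω, Y 0 ω)).map fun q => (q.2 - gh q.1) / sh q.1

namespace HeteroscedasticModel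

variable (hmodel : HeteroscedasticModel P X Y g σ f)
include hmodel

lemma measurable_stdError : Measurable (stdError X Y g σ 0) :=
  ((hmodel.measurable_Y 0).sub (hmodel.measurable_g.comp (hmodel.measurable_X 0))).div
    (hmodel.measurable_σ.comp (hmodel.measurable_X 0))

variable [IsProbabilityMeasure P]

lemma integrable_density : Integrable f ∧ ∫ z, f z = 1 := by
  have h1 : IsProbabilityMeasure (P.map (stdError X Y g σ 0)) :=
    Measure.isProbabilityMeasure_map hmodel.measurable_stdError.aemeasurable
  have h2 : ∫⁻ z, ENNReal.ofReal (f z) = 1 := by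
    have := h1.measure_univ
    rwa [hmodel.density, withDensity_apply _ MeasurableSet.univ, setLIntegral_univ] at this
  have h3 : Integrable f := by
    refine ⟨hmodel.f_measurable.aestronglyMeasurable, ?_⟩
    rw [hasFiniteIntegral_iff_ofReal (ae_of_all _ hmodel.f_nonneg), h2]
    exact ENNReal.one_lt_top
  refine ⟨h3, ?_⟩
  rw [integral_eq_lintegral_of_nonneg_ae (ae_of_all _ hmodel.f_nonneg)
    hmodel.f_measurable.aestronglyMeasurable, h2, ENNReal.toReal_one]

lemma isProbabilityMeasure_residualLaw {gh sh : Cov d → ℝ} (hgh : Measurable gh)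
    (hsh : Measurable sh) : IsProbabilityMeasure (residualLaw P X Y gh sh) := by
  have := Measure.isProbabilityMeasure_map (μ := P)
    ((hmodel.measurable_X 0).prodMk (hmodel.measurable_Y 0)).aemeasurable
  refine Measure.isProbabilityMeasure_map (Measurable.aemeasurable ?_)
  exact (measurable_snd.sub (hgh.comp measurable_fst)).div (hsh.comp measurable_fst)

/-- On the support of `X` the residual equals `a(X) + b(X) ε` with `ε` independent of `X`. Fubini
then reduces the integral to an average over `x`, and almost every `x` lies in the support. -/
lemma integral_residualLaw_le {gh sh : Cov d → ℝ} (hgh : Measurable gh) (hsh : Measurable sh)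
    {ψ : ℝ → ℝ} (hψ : Measurable ψ) {B c : ℝ} (hB : ∀ w, |ψ w| ≤ B)
    (hc : ∀ x ∈ covSupport P X,
      ∫ e, ψ ((g x - gh x) / sh x + σ x / sh x * e) * f e ≤ c) :
    ∫ w, ψ w ∂(residualLaw P X Y gh sh) ≤ c := by
  have hX := hmodel.measurable_X 0
  have hε := hmodel.measurable_stdError
  have hφ : Measurable fun q : Cov d × ℝ => (q.2 - gh q.1) / sh q.1 :=
    (measurable_snd.sub (hgh.comp measurable_fst)).div (hsh.comp measurable_fst)
  have hsupp : ∀ᵐ x ∂(P.map (X 0)), x ∈ covSupport P X := Measure.support_mem_ae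
  have hPX : IsProbabilityMeasure (P.map (X 0)) :=
    Measure.isProbabilityMeasure_map hX.aemeasurable
  have hPε : IsProbabilityMeasure (P.map (stdError X Y g σ 0)) :=
    Measure.isProbabilityMeasure_map hε.aemeasurable
  set Ψ : Cov d × ℝ → ℝ := fun q => ψ ((g q.1 - gh q.1) / sh q.1 + σ q.1 / sh q.1 * q.2) with hΨ
  have hΨm : Measurable Ψ := by
    refine hψ.comp (Measurable.add ?_ (Measurable.mul ?_ measurable_snd))
    · exact ((hmodel.measurable_g.sub hgh).div hsh).comp measurable_fst
    · exact (hmodel.measurable_σ.div hsh).comp measurable_fst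
  have h1 : ∫ w, ψ w ∂(residualLaw P X Y gh sh) = ∫ ω, Ψ (X 0 ω, stdError X Y g σ 0 ω) ∂P := by
    rw [residualLaw, integral_map hφ.aemeasurable hψ.aestronglyMeasurable,
      integral_map (hX.prodMk (hmodel.measurable_Y 0)).aemeasurable
        (by exact (hψ.comp hφ).aestronglyMeasurable)]
    refine integral_congr_ae ?_
    filter_upwards [ae_of_ae_map hX.aemeasurable hsupp] with ω hω
    have hσ := hmodel.σ_pos _ hω
    simp only [hΨ, stdError]
    congr 1
    rw [div_mul_eq_mul_div, mul_div_cancel₀ _ hσ.ne', ← add_div]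
    congr 1
    ring
  have hprod := (indepFun_iff_map_prod_eq_prod_map_map hX.aemeasurable hε.aemeasurable).1
    hmodel.indep_error
  have hΨi : Integrable Ψ ((P.map (X 0)).prod (P.map (stdError X Y g σ 0))) :=
    Integrable.of_bound hΨm.aestronglyMeasurable B (ae_of_all _ fun q => hB _)
  have h2 : ∫ ω, Ψ (X 0 ω, stdError X Y g σ 0 ω) ∂P
      = ∫ x, ∫ e, Ψ (x, e) ∂(P.map (stdError X Y g σ 0)) ∂(P.map (X 0)) := by
    rw [← integral_prod _ hΨi, ← hprod,
      integral_map (hX.prodMk hε).aemeasurable hΨm.aestronglyMeasurable]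
  rw [h1, h2]
  have h3 : ∀ x, ∫ e, Ψ (x, e) ∂(P.map (stdError X Y g σ 0)) = ∫ e, Ψ (x, e) * f e := by
    intro x
    rw [hmodel.density, integral_withDensity_eq_integral_toReal_smul
      hmodel.f_measurable.ennreal_ofReal (ae_of_all _ fun _ => ENNReal.ofReal_lt_top)]
    refine integral_congr_ae (ae_of_all _ fun e => ?_)
    simp only [ENNReal.toReal_ofReal (hmodel.f_nonneg e), smul_eq_mul]
    ring
  refine (integral_mono_ae hΨi.integral_prod_left (integrable_const c) ?_).trans_eq (by simp)
  filter_upwards [hsupp] with x hx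
  simp only [h3]
  exact hc x hx

lemma abs_integral_residualLaw_sub_le {gh sh : Cov d → ℝ} (hgh : Measurable gh)
    (hsh : Measurable sh) {ψ : ℝ → ℝ} (hψ : Measurable ψ) {B c δ : ℝ} (hB : ∀ w, |ψ w| ≤ B)
    (hc : ∀ x ∈ covSupport P X,
      |(∫ e, ψ ((g x - gh x) / sh x + σ x / sh x * e) * f e) - c| ≤ δ) :
    |(∫ w, ψ w ∂(residualLaw P X Y gh sh)) - c| ≤ δ := by
  have h1 := hmodel.integral_residualLaw_le hgh hsh hψ hB (c := c + δ) fun x hx => by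
    linarith [(abs_le.1 (hc x hx)).2]
  have h2 := hmodel.integral_residualLaw_le hgh hsh hψ.neg (c := -c + δ)
    (fun w => by simpa using hB w) fun x hx => by
      have : ∀ e, (-ψ) ((g x - gh x) / sh x + σ x / sh x * e) * f e
          = -(ψ ((g x - gh x) / sh x + σ x / sh x * e) * f e) := fun e => by simp
      simp_rw [this, integral_neg]
      linarith [(abs_le.1 (hc x hx)).1]
  simp only [Pi.neg_apply, integral_neg] at h2
  rw [abs_le]
  constructor <;> linarith

end HeteroscedasticModel

/-- Bounds on the standardized errors of a fit that is uniformly close to the truth. -/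
lemma scale_ratio_bounds {m A B s sh u v : ℝ} (hm : 0 < m) (hms : m ≤ s) (hB : |sh - s| ≤ B)
    (hBm : B ≤ m / 2) (hA : |u - v| ≤ A) :
    0 < s / sh ∧ |(s / sh)⁻¹ - 1| ≤ B / m ∧ |(v - u) / sh| ≤ 2 * A / m := by
  have hs : 0 < s := hm.trans_le hms
  have hsh : m / 2 ≤ sh := by linarith [(abs_le.1 hB).1]
  have hsh0 : 0 < sh := by linarith
  have hA0 : 0 ≤ A := (abs_nonneg _).trans hA
  have hB0 : 0 ≤ B := (abs_nonneg _).trans hB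
  refine ⟨by positivity, ?_, ?_⟩
  · have : (s / sh)⁻¹ - 1 = (sh - s) / s := by field_simp
    rw [this, abs_div, abs_of_pos hs]
    exact div_le_div₀ hB0 hB hm hms
  · rw [abs_div, abs_of_pos hsh0, abs_sub_comm]
    refine (div_le_div₀ hA0 hA (by positivity) hsh).trans_eq ?_
    field_simp

end ResidualLaw

end HPD

namespace HPD

/-! ### Masses of level sets -/

section Mass

variable {f q : ℝ → ℝ}

lemma massLE_mono (hf0 : ∀ z, 0 ≤ f z) (hfi : Integrable f) : Monotone (massLE f) :=
  fun s t hst => by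
    have hsub : {z | f z ≤ s} ⊆ {z | f z ≤ t} := fun z hz => le_trans (mem_ofPred.1 hz) hst
    exact setIntegral_mono_set hfi.integrableOn (ae_of_all _ hf0) hsub.eventuallyLE

lemma setIntegral_upperSet (hfm : Measurable f) (hfi : Integrable f) (hf1 : ∫ z, f z = 1) (t : ℝ) :
    ∫ z in upperSet f t, f z = 1 - massLE f t := by
  have hm : MeasurableSet {z | f z ≤ t} := hfm measurableSet_Iic
  have h := integral_add_compl hm hfi
  have hc : {z | f z ≤ t}ᶜ = upperSet f t := by
    ext z; simp [upperSet]
  rw [hc, hf1] at h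
  simp only [massLE]
  linarith

lemma setIntegral_le_level (hfm : Measurable f) (hfi : Integrable f) (hf1 : ∫ z, f z = 1) (t : ℝ) :
    ∫ z in {z | t ≤ f z}, f z = 1 - massLT f t := by
  have hm : MeasurableSet {z | f z < t} := hfm measurableSet_Iio
  have h := integral_add_compl hm hfi
  have hc : {z | f z < t}ᶜ = {z | t ≤ f z} := by
    ext z; simp
  rw [hc, hf1] at h
  simp only [massLT]
  linarith

lemma upperSet_nonempty_of_massLE_lt_one (hf1 : ∫ z, f z = 1) {t : ℝ} (ht : massLE f t < 1) :
    (upperSet f t).Nonempty := by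
  by_contra h
  have h1 : {z | f z ≤ t} = univ := by
    ext z
    simp only [mem_ofPred_eq, mem_univ, iff_true]
    by_contra! hz
    exact h ⟨z, hz⟩
  rw [massLE, h1, setIntegral_univ, hf1] at ht
  exact lt_irrefl _ ht

lemma abs_setIntegral_sub_le {R δ : ℝ} (hR : 0 ≤ R) (hfi : Integrable f) (hqi : Integrable q)
    (hfq : ∀ z, |z| ≤ R → |q z - f z| ≤ δ) {U : Set ℝ} (hU : ∀ z ∈ U, |z| ≤ R) :
    |(∫ z in U, q z) - ∫ z in U, f z| ≤ 2 * R * δ := by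
  have hδ : 0 ≤ δ := (abs_nonneg _).trans (hfq 0 (by simpa using hR))
  have hsub : U ⊆ Icc (-R) R := fun z hz => abs_le.1 (hU z hz)
  rw [← integral_sub hqi.integrableOn hfi.integrableOn]
  have h := norm_setIntegral_le_of_norm_le_const (μ := volume) (s := U) (C := δ)
    (f := fun z => q z - f z) ((measure_mono hsub).trans_lt (by simp)) (fun z hz => hfq z (hU z hz))
  have hv : volume.real U ≤ 2 * R := by
    refine (measureReal_mono hsub (by simp)).trans_eq ?_
    rw [Real.volume_real_Icc_of_le (by linarith)]
    ring
  calc _ ≤ δ * volume.real U := h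
    _ ≤ δ * (2 * R) := mul_le_mul_of_nonneg_left hv hδ
    _ = _ := by ring

/-- Highest-density cutoffs of two densities that are close to each other are close. -/
lemma abs_cutoff_sub_le (hf0 : ∀ z, 0 ≤ f z) (hfm : Measurable f) (hfi : Integrable f)
    (hf1 : ∫ z, f z = 1) (hq0 : ∀ z, 0 ≤ q z) (hqm : Measurable q) (hqi : Integrable q)
    (hq1 : ∫ z, q z = 1) {α lam R ψ τ₀ b₁ δ k lamHat : ℝ} (hlam : massLE f lam = α)
    (hR : 0 ≤ R) (hδ : 0 < δ) (hb₁ : 0 < b₁)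
    (hfq : ∀ z, |z| ≤ R → |q z - f z| ≤ δ)
    (hfar : ∀ z, R < |z| → q z ≤ lam - ψ ∧ f z ≤ lam - ψ)
    (hγ : ∀ τ ∈ Icc (-τ₀) τ₀, b₁ * |τ| ≤ |massLE f (lam + τ) - α|)
    (hk : k = 2 + 2 * R / b₁) (hψ : k * δ ≤ ψ) (hτ : k * δ ≤ τ₀)
    (hcut : IsCutoff q α lamHat) : |lamHat - lam| ≤ k * δ := by
  -- The choice of `k`: a level shift of `(k - 1) δ` moves a mass of at least `2Rδ + b₁δ`, more than
  -- the discrepancy `2Rδ` between `q` and `f`.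
  have hkb : b₁ * (k - 2) = 2 * R := by rw [hk]; field_simp; ring
  have hk2 : 2 ≤ k := by
    rw [hk]
    have : 0 ≤ 2 * R / b₁ := by positivity
    linarith
  have hmass : b₁ * (k - 1) * δ = b₁ * δ + 2 * R * δ := by
    rw [← hkb]; ring
  have hpos : 0 < b₁ * δ := by positivity
  have hkδ : (k - 1) * δ ≤ k * δ := by nlinarith
  have hkδ0 : 0 < (k - 1) * δ := by
    have : 0 < k - 1 := by linarith
    positivity
  rw [abs_le]
  constructor
  -- If `lamHat` is too low, `{q > lamHat}` contains `{f > t}`, whose `f`-mass is at least `1 - α +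
  -- b₁ (k - 1) δ`. But the `q`-mass of `{q > lamHat}` is at most `1 - α`.
  · by_contra! hlt
    set t := lam + -((k - 1) * δ) with ht
    have hγt := hγ (-((k - 1) * δ)) ⟨by linarith, by linarith⟩
    rw [abs_neg, abs_of_pos hkδ0] at hγt
    have hmono := massLE_mono hf0 hfi (show t ≤ lam by linarith)
    rw [hlam] at hmono
    rw [abs_of_nonpos (by linarith)] at hγt
    have hUR : ∀ z ∈ upperSet f t, |z| ≤ R := by
      intro z hz
      by_contra! hzR
      have h1 : t < f z := hz
      linarith [(hfar z hzR).2]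
    have hUq : upperSet f t ⊆ upperSet q lamHat := by
      intro z hz
      have h1 : t < f z := hz
      have h2 := (abs_le.1 (hfq z (hUR z hz))).1
      change lamHat < q z
      linarith
    have h1 := setIntegral_mono_set hqi.integrableOn (ae_of_all _ hq0) (LE.le.eventuallyLE hUq)
    rw [setIntegral_upperSet hqm hqi hq1] at h1
    have h2 := (abs_le.1 (abs_setIntegral_sub_le hR hfi hqi hfq hUR)).1
    rw [setIntegral_upperSet hfm hfi hf1] at h2
    have h3 := hcut.2
    linarith
  -- The mirror case uses the other half of the cutoff condition, through the closed set `{q ≥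
  -- lamHat}` of `q`-mass at least `1 - α`.
  · by_contra! hlt
    set t := lam + (k - 1) * δ with ht
    have hγt := hγ ((k - 1) * δ) ⟨by linarith, by linarith⟩
    rw [abs_of_pos hkδ0] at hγt
    have hmono := massLE_mono hf0 hfi (show lam ≤ t by linarith)
    rw [hlam] at hmono
    rw [abs_of_nonneg (by linarith)] at hγt
    have hUR : ∀ z ∈ upperSet f t, |z| ≤ R := by
      intro z hz
      by_contra! hzR
      have h1 : t < f z := hz
      linarith [(hfar z hzR).2]
    have hqU : {z | lamHat ≤ q z} ⊆ upperSet f t := by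
      intro z hz
      have hz' : lamHat ≤ q z := hz
      have hzR : |z| ≤ R := by
        by_contra! hzR
        linarith [(hfar z hzR).1]
      have h2 := (abs_le.1 (hfq z hzR)).2
      change t < f z
      linarith
    have h1 := setIntegral_mono_set hqi.integrableOn (ae_of_all _ hq0) (LE.le.eventuallyLE hqU)
    rw [setIntegral_le_level hqm hqi hq1] at h1
    have h2 := (abs_le.1 (abs_setIntegral_sub_le hR hfi hqi hfq hUR)).2
    rw [setIntegral_upperSet hfm hfi hf1] at h2
    have h3 := hcut.1
    linarith

end Mass

/-! ### Distances between level sets -/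

section Distance

variable {f q : ℝ → ℝ}

lemma le_rpow_inv_of_mul_rpow_le {C d δ β : ℝ} (hC : 0 < C) (hβ : 0 < β) (hd : 0 ≤ d)
    (h : C * d ^ β ≤ δ) : d ≤ (δ / C) ^ (1 / β) := by
  have h1 : d ^ β ≤ δ / C := by rw [le_div_iff₀ hC]; linarith
  have h2 := Real.rpow_le_rpow (by positivity) h1 (show 0 ≤ 1 / β by positivity)
  rwa [← Real.rpow_mul hd, mul_one_div_cancel hβ.ne', Real.rpow_one] at h2

/-- Regularity turns a deficit `δ` in level into a distance `(δ / C)^(1/β)`; the factor two is there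
because the infimum defining the distance need not be attained. -/
lemma exists_mem_upperSet_near {lam₀ t δ C β : ℝ} (hC : 0 < C) (hβ : 0 < β) (hδ : 0 < δ)
    (hne : (upperSet f t).Nonempty)
    (hreg : ∀ z ∈ upperSet f lam₀ \ upperSet f t,
      C * Metric.infDist z (upperSet f t) ^ β ≤ t - f z)
    {z : ℝ} (hz₀ : lam₀ < f z) (hz : t - δ ≤ f z) :
    ∃ y ∈ upperSet f t, |z - y| ≤ 2 * (δ / C) ^ (1 / β) := by
  have hr : 0 < (δ / C) ^ (1 / β) := by positivity
  by_cases hzt : z ∈ upperSet f t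
  · exact ⟨z, hzt, by simpa using hr.le⟩
  · have h1 := le_rpow_inv_of_mul_rpow_le hC hβ Metric.infDist_nonneg
      ((hreg z ⟨hz₀, hzt⟩).trans (show t - f z ≤ δ by linarith))
    obtain ⟨y, hy, hyz⟩ := (Metric.infDist_lt_iff hne).1
      (h1.trans_lt (show (δ / C) ^ (1 / β) < 2 * (δ / C) ^ (1 / β) by linarith))
    exact ⟨y, hy, by rw [← Real.dist_eq]; exact hyz.le⟩

lemma hausdorffEDist_locScale_le {c₁ c₂ s₁ s₂ A B R M r : ℝ} {U V : Set ℝ}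
    (hc : |c₁ - c₂| ≤ A) (hs : |s₁ - s₂| ≤ B) (hM : |s₂| ≤ M) (hU : ∀ z ∈ U, |z| ≤ R)
    (hUV : ∀ z ∈ U, ∃ y ∈ V, |z - y| ≤ r) (hVU : ∀ y ∈ V, ∃ z ∈ U, |z - y| ≤ r) :
    Metric.hausdorffEDist (locScale c₁ s₁ U) (locScale c₂ s₂ V)
      ≤ ENNReal.ofReal (A + B * R + M * r) := by
  have key : ∀ z ∈ U, ∀ y, |z - y| ≤ r →
      edist (c₁ + s₁ * z) (c₂ + s₂ * y) ≤ ENNReal.ofReal (A + B * R + M * r) := by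
    intro z hz y hzy
    rw [edist_dist, Real.dist_eq]
    refine ENNReal.ofReal_le_ofReal ?_
    have : c₁ + s₁ * z - (c₂ + s₂ * y) = (c₁ - c₂) + (s₁ - s₂) * z + s₂ * (z - y) := by ring
    rw [this]
    refine (abs_add_three _ _ _).trans ?_
    rw [abs_mul, abs_mul]
    have h1 := mul_le_mul hs (hU z hz) (abs_nonneg _) ((abs_nonneg _).trans hs)
    have h2 := mul_le_mul hM hzy (abs_nonneg _) ((abs_nonneg _).trans hM)
    linarith
  refine Metric.hausdorffEDist_le_of_mem_edist ?_ ?_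
  · rintro _ ⟨z, hz, rfl⟩
    obtain ⟨y, hy, hzy⟩ := hUV z hz
    exact ⟨_, ⟨y, hy, rfl⟩, key z hz y hzy⟩
  · rintro _ ⟨y, hy, rfl⟩
    obtain ⟨z, hz, hzy⟩ := hVU y hy
    exact ⟨_, ⟨z, hz, rfl⟩, by rw [edist_comm]; exact key z hz y hzy⟩

/-- If `q` is within `δ` of `f` on `[-R, R]` and both are small elsewhere, the highest-density
regions of `q` and of `f` are within `O(δ ^ (1 / β))` of each other. -/
lemma highestDensityRegion_near (hf0 : ∀ z, 0 ≤ f z) (hfm : Measurable f) (hfi : Integrable f)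
    (hf1 : ∫ z, f z = 1) (hq0 : ∀ z, 0 ≤ q z) (hqm : Measurable q) (hqi : Integrable q)
    (hq1 : ∫ z, q z = 1) {α lam lam₀ R ψ τ₀ b₁ b₂ C β δ k lamHat : ℝ} (hα : α < 1)
    (hlam : massLE f lam = α) (hlam₀ : lam₀ < lam - ψ)
    (hR : 0 ≤ R) (hδ : 0 < δ) (hb₁ : 0 < b₁) (hC : 0 < C) (hβ : 0 < β)
    (hfq : ∀ z, |z| ≤ R → |q z - f z| ≤ δ)
    (hfar : ∀ z, R < |z| → q z ≤ lam - ψ ∧ f z ≤ lam - ψ)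
    (hγ : ∀ τ ∈ Icc (-τ₀) τ₀,
      b₁ * |τ| ≤ |massLE f (lam + τ) - α| ∧ |massLE f (lam + τ) - α| ≤ b₂ * |τ|)
    (hreg : ∀ t ∈ Icc (lam - ψ) (lam + ψ), ∀ z ∈ upperSet f lam₀ \ upperSet f t,
      C * Metric.infDist z (upperSet f t) ^ β ≤ t - f z)
    (hk : k = 2 + 2 * R / b₁) (hψ : (k + 1) * δ ≤ ψ) (hτ : (k + 1) * δ ≤ τ₀)
    (hb₂ : b₂ * ((k + 1) * δ) < 1 - α) (hcut : IsCutoff q α lamHat) :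
    (∀ z ∈ upperSet q lamHat, |z| ≤ R) ∧
    (∀ z ∈ upperSet q lamHat, ∃ y ∈ upperSet f lam,
      |z - y| ≤ 2 * ((k + 1) * δ / C) ^ (1 / β)) ∧
    ∀ y ∈ upperSet f lam, ∃ z ∈ upperSet q lamHat,
      |z - y| ≤ 2 * ((k + 1) * δ / C) ^ (1 / β) := by
  have hk2 : 2 ≤ k := by
    rw [hk]
    have : 0 ≤ 2 * R / b₁ := by positivity
    linarith
  have hδ' : 0 < (k + 1) * δ := by positivity
  have hclose := abs_cutoff_sub_le hf0 hfm hfi hf1 hq0 hqm hqi hq1 hlam hR hδ hb₁ hfq hfar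
    (fun τ hτ => (hγ τ hτ).1) hk (by linarith) (by linarith) hcut
  rw [abs_le] at hclose
  have hbd : ∀ z ∈ upperSet q lamHat, |z| ≤ R := by
    intro z hz
    by_contra! hzR
    have h1 : lamHat < q z := hz
    linarith [(hfar z hzR).1]
  have hne : (upperSet f lam).Nonempty :=
    upperSet_nonempty_of_massLE_lt_one hf1 (by rw [hlam]; exact hα)
  -- The raised level still leaves positive mass above it, by the upper half of the `γ`-exponent
  -- condition.
  have hne' : (upperSet f (lam + (k + 1) * δ)).Nonempty := by
    refine upperSet_nonempty_of_massLE_lt_one hf1 ?_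
    have h1 := (hγ ((k + 1) * δ) ⟨by linarith, hτ⟩).2
    rw [abs_of_pos hδ'] at h1
    linarith [le_abs_self (massLE f (lam + (k + 1) * δ) - α)]
  refine ⟨hbd, fun z hz => ?_, fun y hy => ?_⟩
  · have h1 : lamHat < q z := hz
    have h2 := (abs_le.1 (hfq z (hbd z hz))).2
    exact exists_mem_upperSet_near hC hβ hδ' hne (hreg lam ⟨by linarith, by linarith⟩)
      (by linarith) (by linarith)
  -- Regularity is applied at the raised level: `y` is close to `{f > lam + (k + 1) δ}`, and this
  -- set lies inside `{q > lamHat}`.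
  · have h1 : lam < f y := hy
    obtain ⟨z, hz, hzy⟩ := exists_mem_upperSet_near hC hβ hδ' hne'
      (hreg (lam + (k + 1) * δ) ⟨by linarith, by linarith⟩) (z := y) (by linarith) (by linarith)
    refine ⟨z, ?_, by rwa [abs_sub_comm]⟩
    have h2 : lam + (k + 1) * δ < f z := hz
    have hzR : |z| ≤ R := by
      by_contra! hzR
      linarith [(hfar z hzR).2]
    have h3 := (abs_le.1 (hfq z hzR)).1
    change lamHat < q z
    linarith

/-- Since `f ≥ 0`, the deficit `lam - f z` is at most `|lam| + 1`, so by regularity the points with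
`f > lam₀` lie at bounded distance from a bounded set. -/
lemma exists_abs_le_of_mem_upperSet {lam lam₀ ψ C β : ℝ} (hf0 : ∀ z, 0 ≤ f z) (hC : 0 < C)
    (hβ : 0 < β) (hψ : 0 < ψ) (hne : (upperSet f lam).Nonempty)
    (hreg : ∀ t ∈ Icc (lam - ψ) (lam + ψ), ∀ z ∈ upperSet f lam₀ \ upperSet f t,
      C * Metric.infDist z (upperSet f t) ^ β ≤ t - f z)
    (hbdd : Bornology.IsBounded (upperSet f lam)) :
    ∃ R, 0 < R ∧ ∀ z, R < |z| → f z ≤ lam₀ := by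
  obtain ⟨R₀, hR₀⟩ := hbdd.exists_norm_le
  have hR₀0 : 0 ≤ R₀ := by
    obtain ⟨z, hz⟩ := hne
    exact (norm_nonneg _).trans (hR₀ z hz)
  have hδ : 0 < |lam| + 1 := by positivity
  refine ⟨R₀ + 2 * ((|lam| + 1) / C) ^ (1 / β), by positivity, fun z hz => ?_⟩
  by_contra! hlt
  obtain ⟨y, hy, hzy⟩ := exists_mem_upperSet_near hC hβ hδ hne
    (hreg lam ⟨by linarith, by linarith⟩) hlt (by linarith [hf0 z, le_abs_self lam])
  have h1 := hR₀ y hy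
  rw [Real.norm_eq_abs] at h1
  have h2 := abs_add_le (z - y) y
  rw [sub_add_cancel] at h2
  linarith

end Distance

/-! ### Kernel density estimates are densities -/

section KDE

variable {K : ℝ → ℝ} {h : ℝ}

lemma kde_nonneg (hK : KernelAssumption K) (hh : 0 < h) (s : Finset ℕ) (v : ℕ → ℝ) (z : ℝ) :
    0 ≤ kde K h s v z :=
  mul_nonneg (by positivity) (Finset.sum_nonneg fun _ _ => hK.nonneg _)

lemma measurable_kde (hK : KernelAssumption K) (s : Finset ℕ) (v : ℕ → ℝ) :
    Measurable (kde K h s v) := by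
  refine Measurable.const_mul (Finset.measurable_sum _ fun i _ => ?_) _
  exact hK.measurable.comp (by fun_prop)

lemma integrable_kernel_comp (hK : KernelAssumption K) (hh : 0 < h) (v : ℝ) :
    Integrable (fun z => K ((v - z) / h)) ∧ ∫ z, K ((v - z) / h) = h := by
  constructor
  · exact (hK.integrable.comp_div hh.ne').comp_sub_left v
  · rw [integral_sub_left_eq_self (fun z => K (z / h)) volume v, Measure.integral_comp_div,
      hK.integral_eq_one, abs_of_pos hh, smul_eq_mul, mul_one]

lemma integrable_kde (hK : KernelAssumption K) (hh : 0 < h) (s : Finset ℕ) (v : ℕ → ℝ) :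
    Integrable (kde K h s v) :=
  (integrable_finsetSum _ fun i _ => (integrable_kernel_comp hK hh (v i)).1).const_mul _

lemma integral_kde (hK : KernelAssumption K) (hh : 0 < h) {s : Finset ℕ} (hs : s.Nonempty)
    (v : ℕ → ℝ) : ∫ z, kde K h s v z = 1 := by
  unfold kde
  rw [integral_const_mul, integral_finsetSum _ fun i _ => (integrable_kernel_comp hK hh (v i)).1]
  simp_rw [(integrable_kernel_comp hK hh _).2]
  have : (s.card : ℝ) ≠ 0 := by exact_mod_cast hs.card_pos.ne'
  rw [Finset.sum_const, nsmul_eq_mul]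
  field_simp

lemma kde_eq_integral_empMeasure (s : Finset ℕ) (v : ℕ → ℝ) (z : ℝ) :
    kde K h s v z = 1 / h * ∫ w, K ((w - z) / h) ∂(empMeasure fun i : s => v i) := by
  rw [integral_empMeasure, kde, Fintype.card_coe,
    Finset.sum_coe_sort s (fun i => K ((v i - z) / h))]
  rw [one_div_mul_eq_div, one_div_mul_eq_div, one_div_mul_eq_div, div_div]

end KDE

end HPD

namespace HPD

/-! ### Numerical consequences of the bandwidth conditions -/

/-- The proxy `V = (4M + 3) h` covers the mass `2M · 2h` of an interval of length `2h` under a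
density bounded by `2M`, and `2/n ≤ 2h`. The deviation `√(12 V log n / n)` gives the exponent `3 log
n`, whose `n⁻³` beats the `(n + 1)²` brackets; `3h ≤ V` keeps it below `2V`. -/
lemma bandwidth_bounds {n : ℕ} {h M : ℝ} (hn : 1 ≤ Real.log n) (hM : 0 ≤ M)
    (hh : Real.log n / n < h) :
    0 < Real.sqrt (12 * ((4 * M + 3) * h) * (Real.log n / n)) ∧
    Real.sqrt (12 * ((4 * M + 3) * h) * (Real.log n / n)) ≤ 2 * ((4 * M + 3) * h) ∧
    2 * M * (2 * h) + 2 / n ≤ (4 * M + 3) * h ∧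
    (n + 1 : ℝ) ^ 2 * (2 * Real.exp (-(n *
      Real.sqrt (12 * ((4 * M + 3) * h) * (Real.log n / n)) ^ 2 / (4 * ((4 * M + 3) * h)))))
      ≤ 8 / n ∧
    1 / h * (Real.sqrt (12 * ((4 * M + 3) * h) * (Real.log n / n)) + 2 / n)
      ≤ (Real.sqrt (12 * (4 * M + 3)) + 2) * Real.sqrt (Real.log n / (n * h)) := by
  have hn2 : (2 : ℝ) ≤ n := by
    have h1 := Real.log_le_sub_one_of_pos (x := n) (by
      rcases Nat.eq_zero_or_pos n with rfl | h0
      · norm_num at hn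
      · exact_mod_cast h0)
    linarith
  have hn0 : (0 : ℝ) < n := by linarith
  have hl : 0 < Real.log n := by linarith
  have hln : 0 < Real.log n / n := by positivity
  have hh0 : 0 < h := hln.trans hh
  have hn1 : 1 / (n : ℝ) ≤ Real.log n / n := by gcongr
  have h2n : 2 / (n : ℝ) ≤ 2 * h := by
    have : 2 / (n : ℝ) = 2 * (1 / n) := by ring
    rw [this]
    linarith
  set V := (4 * M + 3) * h with hV
  have hV0 : 0 < V := by positivity
  have hV3 : 3 * h ≤ V := by rw [hV]; nlinarith
  refine ⟨by positivity, ?_, by linarith, ?_, ?_⟩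
  · rw [Real.sqrt_le_left (by positivity)]
    nlinarith
  · rw [Real.sq_sqrt (by positivity)]
    have h1 : (n : ℝ) * (12 * V * (Real.log n / n)) / (4 * V) = 3 * Real.log n := by
      field_simp; norm_num
    have h2 : Real.exp (-(3 * Real.log n)) = 1 / (n : ℝ) ^ 3 := by
      rw [Real.exp_neg, show 3 * Real.log n = (3 : ℕ) * Real.log n by norm_num, Real.exp_nat_mul,
        Real.exp_log hn0, one_div]
    rw [h1, h2]
    have h3 : ((n : ℝ) + 1) ^ 2 ≤ 4 * n ^ 2 := by nlinarith
    calc ((n : ℝ) + 1) ^ 2 * (2 * (1 / (n : ℝ) ^ 3))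
        ≤ 4 * n ^ 2 * (2 * (1 / (n : ℝ) ^ 3)) := by gcongr
      _ = 8 / (n : ℝ) := by field_simp; norm_num
  · have hu : Real.log n / (n * h) ≤ 1 := by
      rw [← div_div, div_le_one hh0]
      exact hh.le
    have hu0 : 0 ≤ Real.log n / (n * h) := by positivity
    have h1 : 1 / h * Real.sqrt (12 * V * (Real.log n / n))
        = Real.sqrt (12 * (4 * M + 3)) * Real.sqrt (Real.log n / (n * h)) := by
      rw [← Real.sqrt_mul (by positivity)]
      rw [show 12 * V * (Real.log n / n)
        = h ^ 2 * (12 * (4 * M + 3) * (Real.log n / (n * h))) by rw [hV]; field_simp]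
      rw [Real.sqrt_mul (by positivity), Real.sqrt_sq hh0.le]
      field_simp
    have h2 : 1 / h * (2 / n) ≤ 2 * Real.sqrt (Real.log n / (n * h)) := by
      have h3 : 1 / h * (2 / n) ≤ 2 * (Real.log n / (n * h)) := by
        rw [show 1 / h * (2 / (n : ℝ)) = 2 * (1 / (n * h)) by field_simp]
        gcongr
      have h4 : Real.log n / (n * h) ≤ Real.sqrt (Real.log n / (n * h)) := by
        refine Real.le_sqrt_of_sq_le ?_
        nlinarith
      linarith
    rw [mul_add, h1, add_mul]
    linarith

/-! ### The sample-splitting structure -/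

section Splitting

variable {Ω : Type*} {d : ℕ}
  {X : ℕ → Ω → Cov d} {Y : ℕ → Ω → ℝ} {g σ : Cov d → ℝ} {f : ℝ → ℝ}

/-- The residual of an observation as a function of the two training samples. -/
noncomputable def Estimators.residualMap {S : Split} (E : Estimators d S) (n : ℕ)
    (p : ((S.tr₁ n → Cov d × ℝ) × (S.tr₂ n → Cov d × ℝ)) × (Cov d × ℝ)) : ℝ :=
  (p.2.2 - E.loc n p.1.1 p.2.1) / E.scale n p.1.1 p.1.2 p.2.1

lemma Estimators.measurable_residualMap {S : Split} (E : Estimators d S) (n : ℕ) :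
    Measurable (E.residualMap n) := by
  refine (measurable_snd.snd.sub ?_).div ?_
  · exact (E.measurable_loc n).comp (measurable_fst.fst.prodMk measurable_snd.fst)
  · exact (E.measurable_scale n).comp
      (measurable_fst.fst.prodMk (measurable_fst.snd.prodMk measurable_snd.fst))

lemma Estimators.measurable_gHat {S : Split} (E : Estimators d S) (n : ℕ) (ω : Ω) :
    Measurable (gHat E X Y n ω) :=
  (E.measurable_loc n).comp (measurable_const.prodMk measurable_id)

lemma Estimators.measurable_σHat {S : Split} (E : Estimators d S) (n : ℕ) (ω : Ω) :
    Measurable (σHat E X Y n ω) :=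
  (E.measurable_scale n).comp (measurable_const.prodMk (measurable_const.prodMk measurable_id))

variable [MeasurableSpace Ω] {P : Measure Ω}

/-- The law of an observation. -/
noncomputable def obsLaw (P : Measure Ω) (X : ℕ → Ω → Cov d) (Y : ℕ → Ω → ℝ) :
    Measure (Cov d × ℝ) := P.map fun ω => (X 0 ω, Y 0 ω)

namespace HeteroscedasticModel

variable (hmodel : HeteroscedasticModel P X Y g σ f)
include hmodel

lemma measurable_sample (s : Finset ℕ) : Measurable (sample X Y s) :=
  measurable_pi_lambda _ fun i => (hmodel.measurable_X i).prodMk (hmodel.measurable_Y i)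

/-- The training sets may overlap, so independence is taken between their union and the calibration
set. -/
lemma indepFun_training_calibration (S : Split) (n : ℕ) :
    IndepFun (fun ω => (sample X Y (S.tr₁ n) ω, sample X Y (S.tr₂ n) ω))
      (sample X Y (S.cal n)) P := by
  have hdis : Disjoint (S.tr₁ n ∪ S.tr₂ n) (S.cal n) :=
    Finset.disjoint_union_left.2 ⟨S.disjoint₁ n, S.disjoint₂ n⟩
  have h := hmodel.indep.indepFun_finset _ _ hdis fun i =>
    (hmodel.measurable_X i).prodMk (hmodel.measurable_Y i)
  have hm : Measurable fun v : ((S.tr₁ n ∪ S.tr₂ n : Finset ℕ) → Cov d × ℝ) =>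
      ((fun i : S.tr₁ n => v ⟨i, Finset.mem_union_left _ i.2⟩),
        (fun i : S.tr₂ n => v ⟨i, Finset.mem_union_right _ i.2⟩)) :=
    (measurable_pi_lambda _ fun i => measurable_pi_apply _).prodMk
      (measurable_pi_lambda _ fun i => measurable_pi_apply _)
  exact h.comp hm measurable_id

variable [IsProbabilityMeasure P]

lemma isProbabilityMeasure_obsLaw : IsProbabilityMeasure (obsLaw P X Y) :=
  Measure.isProbabilityMeasure_map
    ((hmodel.measurable_X 0).prodMk (hmodel.measurable_Y 0)).aemeasurable

lemma map_sample (s : Finset ℕ) : P.map (sample X Y s) = Measure.pi fun _ => obsLaw P X Y := by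
  have h1 : iIndepFun (fun (i : s) ω => (X i ω, Y i ω)) P :=
    hmodel.indep.precomp Subtype.val_injective
  have h2 := (iIndepFun_iff_map_fun_eq_pi_map fun i : s =>
    ((hmodel.measurable_X i).prodMk (hmodel.measurable_Y i)).aemeasurable).1 h1
  have h3 : ∀ i : s, P.map (fun ω => (X i ω, Y i ω)) = obsLaw P X Y :=
    fun i => (hmodel.identDistrib i).map_eq
  simp_rw [h3] at h2
  exact h2

/-- The event that the calibration residuals deviate from their law given the training data. -/
def _root_.HPD.deviationEvent {S : Split} (E : Estimators d S) (P : Measure Ω)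
    (X : ℕ → Ω → Cov d) (Y : ℕ → Ω → ℝ) (n : ℕ) (M w η : ℝ) : Set Ω :=
  {ω | ((sample X Y (S.tr₁ n) ω, sample X Y (S.tr₂ n) ω), sample X Y (S.cal n) ω)
    ∈ deviationSet (obsLaw P X Y) (E.residualMap n) M w η}

lemma measurableSet_deviationEvent {S : Split} (E : Estimators d S) (n : ℕ) (M w η : ℝ) :
    MeasurableSet (deviationEvent E P X Y n M w η) := by
  have := hmodel.isProbabilityMeasure_obsLaw
  exact (((hmodel.measurable_sample _).prodMk (hmodel.measurable_sample _)).prodMk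
    (hmodel.measurable_sample _))
    (measurableSet_deviationSet (obsLaw P X Y) (E.measurable_residualMap n) M w η)

lemma measureReal_deviationEvent_le {S : Split} (E : Estimators d S) {n : ℕ} (hn : 0 < n)
    {M w V s : ℝ} (hV : M * w + 2 / n ≤ V) (hs : 0 < s) (hsV : s ≤ 2 * V) :
    P.real (deviationEvent E P X Y n M w (s + 2 / n))
      ≤ (n + 1) ^ 2 * (2 * Real.exp (-(n * s ^ 2 / (4 * V)))) := by
  have := hmodel.isProbabilityMeasure_obsLaw
  have hcard : Fintype.card (S.cal n) = n := by rw [Fintype.card_coe, S.card_cal]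
  have : Nonempty (S.cal n) := by
    rw [← Fintype.card_pos_iff, hcard]
    exact hn
  have h := measureReal_deviationSet_le P
    (T := fun ω => (sample X Y (S.tr₁ n) ω, sample X Y (S.tr₂ n) ω))
    ((hmodel.measurable_sample _).prodMk (hmodel.measurable_sample _))
    (hmodel.measurable_sample (S.cal n)) (hmodel.indepFun_training_calibration S n)
    (obsLaw P X Y) (hmodel.map_sample _) (E.measurable_residualMap n) (M := M) (w := w)
    (V := V) (s := s) (by rw [hcard]; exact hV) hs hsV
  rw [hcard] at h
  exact h

/-- The bound `hM` puts the fit among those the deviation event monitors; off that event, rational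
intervals of length `2h`, and hence real ones of length `h`, have empirical error at most `η`. -/
lemma abs_fHat_sub_le_of_notMem {S : Split} (E : Estimators d S) {K : ℝ → ℝ}
    {n : ℕ} (hn : 0 < n) {h : ℕ → ℝ} (hh : 0 < h n) {CK M η : ℝ} (hη : 0 ≤ η)
    (hCK : ∀ (μ ν : Measure ℝ) [IsProbabilityMeasure μ] [IsProbabilityMeasure ν]
      (h D : ℝ), 0 < h → 0 ≤ D →
      (∀ c d, c ≤ d → d ≤ c + h → |μ.real (Ioc c d) - ν.real (Ioc c d)| ≤ D) →
      ∀ z, |∫ w, K ((w - z) / h) ∂μ - ∫ w, K ((w - z) / h) ∂ν| ≤ CK * D)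
    {ω : Ω} (hω : ω ∉ deviationEvent E P X Y n M (2 * h n) η)
    (hM : ∀ c d, c ≤ d →
      (residualLaw P X Y (gHat E X Y n ω) (σHat E X Y n ω)).real (Ioc c d) ≤ M * (d - c)) (z : ℝ) :
    |fHat E X Y K h n ω z
        - 1 / h n * ∫ w, K ((w - z) / h n) ∂(residualLaw P X Y (gHat E X Y n ω) (σHat E X Y n ω))|
      ≤ CK * (1 / h n * η) := by
  have hcard : Fintype.card (S.cal n) = n := by rw [Fintype.card_coe, S.card_cal]
  have : Nonempty (S.cal n) := by
    rw [← Fintype.card_pos_iff, hcard]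
    exact hn
  have hlaw := hmodel.isProbabilityMeasure_residualLaw
    (E.measurable_gHat (X := X) (Y := Y) n ω) (E.measurable_σHat (X := X) (Y := Y) n ω)
  set μ := residualLaw P X Y (gHat E X Y n ω) (σHat E X Y n ω) with hμ
  have hclose : ∀ c d : ℚ, (c : ℝ) ≤ d → (d : ℝ) ≤ c + 2 * h n →
      |(empMeasure fun i : S.cal n => residual E X Y n ω i).real (Ioc (c : ℝ) d)
        - μ.real (Ioc (c : ℝ) d)| ≤ η := by
    intro c d hcd hd
    rw [empMeasure_real _ measurableSet_Ioc]
    by_contra! hlt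
    exact hω ⟨fun c d hcd => hM c d hcd, c, d, hcd, hd, hlt⟩
  have h1 := hCK (empMeasure fun i : S.cal n => residual E X Y n ω i) μ (h n) η hh hη
    (fun c d hcd hd => abs_measureReal_Ioc_sub_le_of_rat hh hclose hcd hd) z
  rw [fHat, kde_eq_integral_empMeasure, ← mul_sub, abs_mul, abs_of_pos (by positivity)]
  calc _ ≤ 1 / h n * (CK * η) := mul_le_mul_of_nonneg_left h1 (by positivity)
    _ = _ := by ring

end HeteroscedasticModel

end Splitting

/-! ### Uniform rates on events of large probability -/

section Rates

variable {Ω : Type*} [MeasurableSpace Ω] {P : Measure Ω} {d : ℕ} {A : Set (Cov d)}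

lemma abs_sub_le_of_supDev_le {u v : Cov d → ℝ} {k : ℕ} {r : ℝ} (hr : 0 ≤ r)
    (h : supDev A u v ≤ k * ENNReal.ofReal r) : ∀ x ∈ A, |u x - v x| ≤ k * r := by
  intro x hx
  have h1 : ENNReal.ofReal |u x - v x| ≤ supDev A u v :=
    le_iSup₂ (f := fun x (_ : x ∈ A) => ENNReal.ofReal |u x - v x|) x hx
  have h2 : (k : ℝ≥0∞) * ENNReal.ofReal r = ENNReal.ofReal (k * r) := by
    rw [ENNReal.ofReal_mul (by positivity), ENNReal.ofReal_natCast]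
  exact (ENNReal.ofReal_le_ofReal_iff (by positivity)).1 ((h1.trans h).trans_eq h2)

/-- The random constants and starting indices are almost surely finite, so the events on which one
integer `k` bounds both increase to probability one. They are only null-measurable, hence the
passage to a measurable subset. -/
lemma exists_measurableSet_supDev_le [IsProbabilityMeasure P] {uh vh : ℕ → Ω → Cov d → ℝ}
    {u v : Cov d → ℝ} {a b : ℕ → ℝ} (ha : ∀ n, 0 ≤ a n) (hb : ∀ n, 0 ≤ b n)
    (hu : UniformStrongRate P A uh u a) (hv : UniformStrongRate P A vh v b)
    {ε : ℝ} (hε : 0 < ε) :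
    ∃ (k : ℕ) (H : Set Ω), MeasurableSet H ∧ 1 - ε ≤ P.real H ∧ ∀ ω ∈ H, ∀ n, k ≤ n →
      ∀ x ∈ A, |uh n ω x - u x| ≤ k * a n ∧ |vh n ω x - v x| ≤ k * b n := by
  set G : ℕ → Set Ω := fun k => ⋂ (n : ℕ) (_ : k ≤ n),
    ({ω | supDev A (uh n ω) u ≤ k * ENNReal.ofReal (a n)} ∩
      {ω | supDev A (vh n ω) v ≤ k * ENNReal.ofReal (b n)}) with hG
  have hGnull : ∀ k, NullMeasurableSet (G k) P := by
    intro k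
    refine NullMeasurableSet.iInter fun n => NullMeasurableSet.iInter fun _ => ?_
    exact (nullMeasurableSet_le (hu.1 n) aemeasurable_const).inter
      (nullMeasurableSet_le (hv.1 n) aemeasurable_const)
  have hGmono : Monotone G := by
    intro j k hjk ω hω
    simp only [hG, mem_iInter, mem_inter_iff, mem_ofPred_eq] at hω ⊢
    have hjk' : (j : ℝ≥0∞) ≤ k := by exact_mod_cast hjk
    exact fun n hn => ⟨(hω n (hjk.trans hn)).1.trans (by gcongr),
      (hω n (hjk.trans hn)).2.trans (by gcongr)⟩
  have hGfull : P (⋃ k, G k) = 1 := by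
    rw [prob_compl_eq_zero_iff₀ (NullMeasurableSet.iUnion hGnull) |>.symm]
    refine mem_ae_iff.1 ?_
    filter_upwards [hu.2, hv.2] with ω ⟨C, hC⟩ ⟨D, hD⟩
    obtain ⟨N₁, hN₁⟩ := eventually_atTop.1 hC
    obtain ⟨N₂, hN₂⟩ := eventually_atTop.1 hD
    obtain ⟨N₃, hN₃⟩ := exists_nat_ge C
    obtain ⟨N₄, hN₄⟩ := exists_nat_ge D
    refine mem_iUnion.2 ⟨max (max N₁ N₂) (max N₃ N₄), ?_⟩
    simp only [hG, mem_iInter, mem_inter_iff, mem_ofPred_eq]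
    intro n hn
    have e1 : (C : ℝ≥0∞) ≤ (max (max N₁ N₂) (max N₃ N₄) : ℕ) := by
      have : C ≤ ((max (max N₁ N₂) (max N₃ N₄) : ℕ) : ℝ≥0) :=
        hN₃.trans (by exact_mod_cast (le_max_left _ _).trans (le_max_right _ _))
      exact_mod_cast this
    have e2 : (D : ℝ≥0∞) ≤ (max (max N₁ N₂) (max N₃ N₄) : ℕ) := by
      have : D ≤ ((max (max N₁ N₂) (max N₃ N₄) : ℕ) : ℝ≥0) :=
        hN₄.trans (by exact_mod_cast (le_max_right _ _).trans (le_max_right _ _))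
      exact_mod_cast this
    exact ⟨(hN₁ n (by omega)).trans (by gcongr), (hN₂ n (by omega)).trans (by gcongr)⟩
  have hlim := tendsto_measure_iUnion_atTop (μ := P) hGmono
  rw [hGfull] at hlim
  have hlim' : Tendsto (fun k => P.real (G k)) atTop (𝓝 1) :=
    (ENNReal.tendsto_toReal ENNReal.one_ne_top).comp hlim
  obtain ⟨k, hk⟩ := (hlim'.eventually (lt_mem_nhds (show 1 - ε < 1 by linarith))).exists
  obtain ⟨H, hHsub, hHm, hHae⟩ := (hGnull k).exists_measurable_subset_ae_eq
  refine ⟨k, H, hHm, ?_, fun ω hω n hn x hx => ?_⟩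
  · rw [measureReal_congr hHae]
    exact hk.le
  · have h1 := hHsub hω
    simp only [hG, mem_iInter, mem_inter_iff, mem_ofPred_eq] at h1
    exact ⟨abs_sub_le_of_supDev_le (ha n) (h1 n hn).1 x hx,
      abs_sub_le_of_supDev_le (hb n) (h1 n hn).2 x hx⟩

end Rates

end HPD

namespace HPD

/-! ### Uniform error of the density estimate for a given sample -/

section Pathwise

variable {Ω : Type*} [MeasurableSpace Ω] {P : Measure Ω} [IsProbabilityMeasure P] {d : ℕ}
  {X : ℕ → Ω → Cov d} {Y : ℕ → Ω → ℝ} {g σ : Cov d → ℝ} {f : ℝ → ℝ}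

/-- Bias and deviation of the kernel density estimate for a fit that is uniformly close to the
truth, off the deviation event. Because `f` is Lipschitz and is at most `t` off a bounded set, the
density of the residuals inherits the rate of the fit, so that `ResidualDensityRate` need not be
assumed. -/
lemma HeteroscedasticModel.fHat_bounds (hmodel : HeteroscedasticModel P X Y g σ f)
    {S : Split} (E : Estimators d S) {K : ℝ → ℝ} (hK : KernelAssumption K)
    {n : ℕ} (hn : 0 < n) {h : ℕ → ℝ} (hh : 0 < h n) {CK M L R t m A B η : ℝ} (hη : 0 ≤ η)
    (hCK : ∀ (μ ν : Measure ℝ) [IsProbabilityMeasure μ] [IsProbabilityMeasure ν]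
      (h D : ℝ), 0 < h → 0 ≤ D →
      (∀ c d, c ≤ d → d ≤ c + h → |μ.real (Ioc c d) - ν.real (Ioc c d)| ≤ D) →
      ∀ z, |∫ w, K ((w - z) / h) ∂μ - ∫ w, K ((w - z) / h) ∂ν| ≤ CK * D)
    (hM : ∀ z, |f z| ≤ M) (hL : ∀ z z', |f z - f z'| ≤ L * |z - z'|)
    (hR : 0 < R) (ht : 0 ≤ t) (hft : ∀ z, R < |z| → f z ≤ t)
    (hm : 0 < m) (hσ : ∀ x ∈ covSupport P X, m ≤ σ x)
    (hB0 : 0 ≤ B) (hBm : B ≤ m / 2) (hAm : 2 * A / m ≤ R) {ω : Ω}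
    (hA : ∀ x ∈ covSupport P X, |gHat E X Y n ω x - g x| ≤ A)
    (hB : ∀ x ∈ covSupport P X, |σHat E X Y n ω x - σ x| ≤ B)
    (hω : ω ∉ deviationEvent E P X Y n (2 * M) (2 * h n) η) :
    (∀ z, |z| ≤ 4 * R → |fHat E X Y K h n ω z - f z|
      ≤ CK * (1 / h n * η) + (B / m * (M + L * (4 * R)) + 2 * L * (2 * A / m)
        + 2 * L * h n * ∫ u, |u| * K u)) ∧
    ∀ z, 4 * R < |z| → fHat E X Y K h n ω z
      ≤ t + (CK * (1 / h n * η) + (B / m * t + 2 * M / R * h n * ∫ u, |u| * K u)) := by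
  have hgm := E.measurable_gHat (X := X) (Y := Y) n ω
  have hsm := E.measurable_σHat (X := X) (Y := Y) n ω
  have hr0 : 0 ≤ B / m := by positivity
  have hr : B / m ≤ 1 / 2 := by rw [div_le_iff₀ hm]; linarith
  have hL0 : 0 ≤ L := by
    have := (abs_nonneg _).trans (hL 1 0)
    simpa using this
  have hratio := fun x hx => scale_ratio_bounds hm (hσ x hx) (hB x hx) hBm (hA x hx)
  have hKz : ∀ z, Measurable fun w : ℝ => K ((w - z) / h n) := fun z =>
    hK.measurable.comp (by fun_prop)
  have hK0 : ∀ z w : ℝ, |K ((w - z) / h n)| ≤ K 0 := fun z w => by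
    rw [abs_of_nonneg (hK.nonneg _)]
    exact hK.le_zero _
  -- The law of `a + b ε` has density at most `b⁻¹ M ≤ 2M`, and averaging over `X` preserves this.
  have hdens : ∀ c d, c ≤ d →
      (residualLaw P X Y (gHat E X Y n ω) (σHat E X Y n ω)).real (Ioc c d) ≤ 2 * M * (d - c) := by
    intro c d hcd
    have h1 := hmodel.integral_residualLaw_le hgm hsm (B := 1) (c := 2 * M * (d - c))
      (ψ := (Ioc c d).indicator fun _ => (1 : ℝ)) (measurable_const.indicator measurableSet_Ioc)
      (fun w => by by_cases hw : w ∈ Ioc c d <;> simp [indicator, hw]) fun x hx => by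
        obtain ⟨e1, e2, e3⟩ := hratio x hx
        exact integral_indicator_affine_le hM hcd e1 (by linarith [(abs_le.1 e2).2])
    rwa [integral_indicator_const _ measurableSet_Ioc, smul_eq_mul, mul_one] at h1
  have hdev := hmodel.abs_fHat_sub_le_of_notMem E hn hh hη hCK hω hdens
  constructor
  · intro z hz
    have h1 := hmodel.abs_integral_residualLaw_sub_le hgm hsm (hKz z) (hK0 z) (c := h n * f z)
      fun x hx => by
        obtain ⟨e1, e2, e3⟩ := hratio x hx
        exact abs_integral_kernel_affine_sub_le hK hmodel.f_measurable hM hL e1 hh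
          (by linarith) e2 e3 (z := z)
    have h2 : |1 / h n * (∫ w, K ((w - z) / h n)
          ∂(residualLaw P X Y (gHat E X Y n ω) (σHat E X Y n ω))) - f z|
        ≤ B / m * (M + L * |z|) + 2 * L * (2 * A / m) + 2 * L * h n * ∫ u, |u| * K u := by
      have e : 1 / h n * (∫ w, K ((w - z) / h n)
          ∂(residualLaw P X Y (gHat E X Y n ω) (σHat E X Y n ω))) - f z
          = 1 / h n * ((∫ w, K ((w - z) / h n)
          ∂(residualLaw P X Y (gHat E X Y n ω) (σHat E X Y n ω))) - h n * f z) := by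
        field_simp
      rw [e, abs_mul, abs_of_pos (by positivity)]
      calc _ ≤ 1 / h n * (h n * _) := mul_le_mul_of_nonneg_left h1 (by positivity)
        _ = _ := by field_simp
    have h3 : B / m * (M + L * |z|) ≤ B / m * (M + L * (4 * R)) := by gcongr
    have h4 := hdev z
    rw [abs_le] at *
    constructor <;> linarith [h2.1, h2.2, h4.1, h4.2]
  · intro z hz
    have h1 := hmodel.integral_residualLaw_le hgm hsm (hKz z) (hK0 z)
      (c := h n * (t + B / m * t + 2 * M / R * h n * ∫ u, |u| * K u)) fun x hx => by
        obtain ⟨e1, e2, e3⟩ := hratio x hx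
        exact integral_kernel_affine_le_of_far hK hmodel.f_measurable hM hR ht hft e1 hh hr e2
          (e3.trans hAm) hz
    have h2 : 1 / h n * (∫ w, K ((w - z) / h n)
          ∂(residualLaw P X Y (gHat E X Y n ω) (σHat E X Y n ω)))
        ≤ t + B / m * t + 2 * M / R * h n * ∫ u, |u| * K u := by
      rw [one_div_mul_eq_div, div_le_iff₀ hh]
      linarith
    linarith [(abs_le.1 (hdev z)).2]

/-- Each error source is dominated by the total rate `s`, so one constant serves both near and far
from the region. -/
lemma error_terms_le {CK c₀ k m M L R κ t h u a b s e : ℝ} (hCK : 0 ≤ CK) (hk : 0 ≤ k)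
    (hm : 0 ≤ m) (hM : 0 ≤ M) (hL : 0 ≤ L) (hR : 0 ≤ R) (hκ : 0 ≤ κ) (ht : 0 ≤ t) (hc₀ : 0 ≤ c₀)
    (he : e ≤ c₀ * u) (hs : 0 ≤ s) (hus : u ≤ s) (hhs : h ≤ s) (has : a ≤ s) (hbs : b ≤ s) :
    CK * e + (k * b / m * (M + L * (4 * R)) + 2 * L * (2 * (k * a) / m) + 2 * L * h * κ)
      ≤ (CK * c₀ + k / m * (M + L * (4 * R)) + 2 * L * (2 * k / m) + 2 * L * κ + k / m * t
        + 2 * M / R * κ) * s ∧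
    CK * e + (k * b / m * t + 2 * M / R * h * κ)
      ≤ (CK * c₀ + k / m * (M + L * (4 * R)) + 2 * L * (2 * k / m) + 2 * L * κ + k / m * t
        + 2 * M / R * κ) * s := by
  have d1 : CK * e ≤ CK * c₀ * s := by
    rw [mul_assoc]
    refine mul_le_mul_of_nonneg_left (he.trans ?_) hCK
    gcongr
  have d2 : k * b / m * (M + L * (4 * R)) ≤ k / m * (M + L * (4 * R)) * s := by
    calc k * b / m * (M + L * (4 * R)) = k / m * (M + L * (4 * R)) * b := by ring
      _ ≤ _ := by gcongr
  have d3 : 2 * L * (2 * (k * a) / m) ≤ 2 * L * (2 * k / m) * s := by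
    calc 2 * L * (2 * (k * a) / m) = 2 * L * (2 * k / m) * a := by ring
      _ ≤ _ := by gcongr
  have d4 : 2 * L * h * κ ≤ 2 * L * κ * s := by
    calc 2 * L * h * κ = 2 * L * κ * h := by ring
      _ ≤ _ := by gcongr
  have d5 : k * b / m * t ≤ k / m * t * s := by
    calc k * b / m * t = k / m * t * b := by ring
      _ ≤ _ := by gcongr
  have d6 : 2 * M / R * h * κ ≤ 2 * M / R * κ * s := by
    calc 2 * M / R * h * κ = 2 * M / R * κ * h := by ring
      _ ≤ _ := by gcongr
  have p2 : 0 ≤ k / m * (M + L * (4 * R)) * s := by positivity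
  have p3 : 0 ≤ 2 * L * (2 * k / m) * s := by positivity
  have p4 : 0 ≤ 2 * L * κ * s := by positivity
  have p5 : 0 ≤ k / m * t * s := by positivity
  have p6 : 0 ≤ 2 * M / R * κ * s := by positivity
  constructor <;> linarith

end Pathwise

end HPD

/-! ### The rate for the estimated highest-density region -/

set_option maxHeartbeats 1000000 in
open HPD in
theorem theorem2 {Ω : Type*} [MeasurableSpace Ω] (P : Measure Ω) [IsProbabilityMeasure P]
    {d : ℕ} (X : ℕ → Ω → Cov d) (Y : ℕ → Ω → ℝ) (g σ : Cov d → ℝ) (f : ℝ → ℝ)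
    (S : Split) (E : Estimators d S) (K : ℝ → ℝ) (h a b : ℕ → ℝ) (α lam β : ℝ)
    (hα : 0 < α ∧ α < 1)
    (hlam : massLE f lam = α)
    -- the i.i.d. heteroscedastic regression model and the kernel
    (hmodel : HeteroscedasticModel P X Y g σ f)
    (hK : KernelAssumption K)
    -- the density is bounded and Lipschitz
    (hbdd : ∃ M : ℝ, ∀ z, |f z| < M)
    (hlip : HolderSmooth f 1)
    -- the bandwidth
    (hh : Tendsto h atTop (𝓝 0))
    (hnh : Tendsto (fun n : ℕ => Real.log n / (n * h n)) atTop (𝓝 0))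
    (hlog : ∀ᶠ n : ℕ in atTop, Real.log n / n < h n)
    -- the level sets of the density near the cutoff
    (hβ : 0 < β)
    (hlevel : LevelRegular f lam β)
    (hγ : GammaExponent f α lam 1)
    -- boundedness of the location, the scale and the oracle region
    (hg : ∃ M : ℝ, ∀ x ∈ covSupport P X, |g x| ≤ M)
    (hσ : ∃ m M : ℝ, 0 < m ∧ ∀ x ∈ covSupport P X, m ≤ σ x ^ 2 ∧ σ x ^ 2 ≤ M)
    (hregion : Bornology.IsBounded (upperSet f lam))
    -- uniform strong consistency of the fitted location and scale
    (ha : ∀ n, 0 ≤ a n) (hb : ∀ n, 0 ≤ b n)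
    (ha0 : Tendsto a atTop (𝓝 0)) (hb0 : Tendsto b atTop (𝓝 0))
    (hgHat : UniformStrongRate P (covSupport P X) (gHat E X Y) g a)
    (hσHat : UniformStrongRate P (covSupport P X) (σHat E X Y) σ b)
    (hres : ResidualDensityRate P X (gHat E X Y) (σHat E X Y) g σ f (fun n => a n + b n)) :
    ∃ C₀ : ℝ, ∀ ε : ℝ, 0 < ε → ∃ C : ℝ, ∀ᶠ n : ℕ in atTop,
      ∃ A : Set Ω, MeasurableSet A ∧ 1 - C₀ / n - ε ≤ P.real A ∧
        ∀ ω ∈ A, ∀ lamHat : ℝ, IsCutoff (fHat E X Y K h n ω) α lamHat →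
          ∀ x ∈ covSupport P X,
            Metric.hausdorffEDist
              (locScale (gHat E X Y n ω x) (σHat E X Y n ω x)
                (upperSet (fHat E X Y K h n ω) lamHat))
              (locScale (g x) (σ x) (upperSet f lam))
            < ENNReal.ofReal (C * (a n + b n +
                (h n + Real.sqrt (Real.log n / (n * h n)) + a n + b n) ^ (1 / β))) := by
  obtain ⟨M, hM'⟩ := hbdd
  have hM : ∀ z, |f z| ≤ M := fun z => (hM' z).le
  have hM0 : 0 ≤ M := (abs_nonneg _).trans (hM 0)
  obtain ⟨L, hL0, hL'⟩ := hlip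
  have hL : ∀ z z', |f z - f z'| ≤ L * |z - z'| := fun z z' => by simpa using hL' z z'
  obtain ⟨lam₀, ψ, C₁, C₂, hψ, hC₁, -, hlam₀, hreg', -⟩ := hlevel
  have hreg : ∀ t ∈ Icc (lam - ψ) (lam + ψ), ∀ z ∈ upperSet f lam₀ \ upperSet f t,
      C₁ * Metric.infDist z (upperSet f t) ^ β ≤ t - f z := fun t ht z hz => (hreg' t ht z hz).1
  obtain ⟨τ₀, b₁, b₂, hτ₀, hb₁, hb₂, hγ'⟩ := hγ
  have hγ : ∀ τ ∈ Icc (-τ₀) τ₀,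
      b₁ * |τ| ≤ |massLE f (lam + τ) - α| ∧ |massLE f (lam + τ) - α| ≤ b₂ * |τ| :=
    fun τ hτ => by simpa using hγ' τ hτ
  obtain ⟨m₀, Mσ, hm₀, hσ'⟩ := hσ
  obtain ⟨hfi, hf1⟩ := hmodel.integrable_density
  have hf0 := hmodel.f_nonneg
  have hne : (upperSet f lam).Nonempty :=
    upperSet_nonempty_of_massLE_lt_one hf1 (by rw [hlam]; exact hα.2)
  obtain ⟨R, hR, hfar⟩ := exists_abs_le_of_mem_upperSet hf0 hC₁ hβ hψ hne hreg hregion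
  have hlam₀0 : 0 ≤ lam₀ := (hf0 _).trans (hfar (R + 1) (by
    rw [abs_of_pos (by linarith)]; linarith))
  obtain ⟨CK, hCK0, hCK⟩ := hK.exists_abs_integral_sub_le
  set m := Real.sqrt m₀ with hm_def
  have hm : 0 < m := Real.sqrt_pos.2 hm₀
  have hσm : ∀ x ∈ covSupport P X, m ≤ σ x := fun x hx =>
    Real.sqrt_le_iff.2 ⟨(hmodel.σ_pos x hx).le, (hσ' x hx).1⟩
  have hσM : ∀ x ∈ covSupport P X, |σ x| ≤ Real.sqrt Mσ := fun x hx =>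
    Real.abs_le_sqrt (hσ' x hx).2
  set κ := ∫ u, |u| * K u with hκ
  have hκ0 : 0 ≤ κ := integral_nonneg fun u => mul_nonneg (abs_nonneg _) (hK.nonneg _)
  set s : ℕ → ℝ := fun n => h n + Real.sqrt (Real.log n / (n * h n)) + a n + b n with hs
  have hs0 : Tendsto s atTop (𝓝 0) := by
    have h1 := (Real.continuous_sqrt.tendsto 0).comp hnh
    rw [Real.sqrt_zero] at h1
    simpa using ((hh.add h1).add ha0).add hb0
  refine ⟨8, fun ε hε => ?_⟩
  obtain ⟨k, H, hHm, hHP, hH⟩ := exists_measurableSet_supDev_le ha hb hgHat hσHat hε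
  -- the rate of uniform convergence of the density estimate
  set D : ℝ := CK * (Real.sqrt (12 * (4 * M + 3)) + 2) + k / m * (M + L * (4 * R))
    + 2 * L * (2 * k / m) + 2 * L * κ + k / m * lam₀ + 2 * M / R * κ with hD
  have hD0 : 0 < D := by positivity
  -- The cutoff constant for the interval `[-4R, 4R]`, on which the estimate is uniformly close to
  -- `f`.
  set q : ℝ := 2 + 2 * (4 * R) / b₁ with hq
  have hq0 : 0 < q := by positivity
  set r : ℝ := ((q + 1) * D / C₁) ^ (1 / β) with hr
  have hr0 : 0 < r := by positivity
  -- The summands pay for the error in location, the error in scale times the radius of the region,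
  -- and the displacement of the level set times the true scale; the final `1` makes the inequality
  -- strict.
  refine ⟨k + k * (4 * R) + 2 * Real.sqrt Mσ * r + 1, ?_⟩
  have hev : ∀ c : ℝ, ∀ y : ℝ, 0 < y → ∀ᶠ n in atTop, c * s n < y := by
    intro c y hy
    have := hs0.const_mul c
    rw [mul_zero] at this
    exact this.eventually (gt_mem_nhds hy)
  have hlog1 : ∀ᶠ n : ℕ in atTop, 1 ≤ Real.log n :=
    (Real.tendsto_log_atTop.comp tendsto_natCast_atTop_atTop).eventually_ge_atTop 1
  -- The level shift `(q + 1) D s n` has to stay within `ψ` and `τ₀` and leave mass above the raised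
  -- level; `D s n` has to keep the estimate below `lam - ψ` far out; the last two conditions keep
  -- the fitted scale away from zero and the standardized location error below `R`.
  filter_upwards [hlog, hlog1, eventually_ge_atTop k, eventually_gt_atTop 0,
    hev ((q + 1) * D) ψ hψ, hev ((q + 1) * D) τ₀ hτ₀,
    hev (b₂ * ((q + 1) * D)) (1 - α) (by linarith [hα.2]),
    hev D (lam - ψ - lam₀) (by linarith), hev k (m / 2) (by positivity),
    hev (2 * k / m) R hR] with n hlogn hlog1n hkn hn0 e1 e2 e3 e4 e5 e6
  have hln : 0 ≤ Real.log n / n := by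
    have : (0 : ℝ) ≤ n := by positivity
    exact div_nonneg (by linarith) this
  have hhn : 0 < h n := hln.trans_lt hlogn
  obtain ⟨w1, w2, w3, w4, w5⟩ := bandwidth_bounds hlog1n hM0 hlogn
  set sd := Real.sqrt (12 * ((4 * M + 3) * h n) * (Real.log n / n)) with hsd
  set u := Real.sqrt (Real.log n / (n * h n)) with hu
  have hu0 : 0 ≤ u := Real.sqrt_nonneg _
  have hsn : s n = h n + u + a n + b n := rfl
  have han := ha n
  have hbn := hb n
  have hsn0 : 0 < s n := by linarith
  have has : a n ≤ s n := by linarith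
  have hbs : b n ≤ s n := by linarith
  have hhs : h n ≤ s n := by linarith
  have hus : u ≤ s n := by linarith
  set η := sd + 2 / n with hη
  refine ⟨H \ deviationEvent E P X Y n (2 * M) (2 * h n) η,
    hHm.diff (hmodel.measurableSet_deviationEvent E n _ _ _), ?_, ?_⟩
  · have h1 := (hmodel.measureReal_deviationEvent_le E hn0 w3 w1 w2).trans w4
    have h2 := le_measureReal_sdiff (μ := P) (s₁ := H)
      (s₂ := deviationEvent E P X Y n (2 * M) (2 * h n) η)
    linarith
  rintro ω ⟨hωH, hω⟩ lamHat hcut x hx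
  have hdev := fun x hx => hH ω hωH n hkn x hx
  have hBm : k * b n ≤ m / 2 := by
    have : (k : ℝ) * b n ≤ k * s n := by gcongr
    linarith
  have hAm : 2 * (k * a n) / m ≤ R := by
    have h1 : 2 * k / m * a n ≤ 2 * k / m * s n := by gcongr
    have h2 : 2 * (k * a n) / m = 2 * k / m * a n := by ring
    linarith
  obtain ⟨hnear, haway⟩ := hmodel.fHat_bounds E hK hn0 hhn (by positivity) hCK hM hL hR hlam₀0 hfar
    hm hσm (by positivity) hBm hAm (fun x hx => (hdev x hx).1) (fun x hx => (hdev x hx).2) hω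
  obtain ⟨hD₁, hD₂⟩ := error_terms_le (e := 1 / h n * η) hCK0.le (Nat.cast_nonneg k) hm.le hM0
    hL0.le hR.le hκ0 hlam₀0 (by positivity) w5 hsn0.le hus hhs has hbs
  rw [← hD] at hD₁ hD₂
  have hδ : 0 < D * s n := by positivity
  obtain ⟨hbd, hUV, hVU⟩ := highestDensityRegion_near hf0 hmodel.f_measurable hfi hf1
    (fun z => kde_nonneg hK hhn _ _ z) (measurable_kde hK _ _) (integrable_kde hK hhn _ _)
    (integral_kde hK hhn (Finset.card_pos.1 (by rw [S.card_cal]; exact hn0)) _)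
    hα.2 hlam hlam₀ (R := 4 * R) (by positivity) hδ hb₁ hC₁ hβ
    (fun z hz => (hnear z hz).trans hD₁)
    (fun z hz => ⟨(haway z hz).trans (by linarith), (hfar z (by linarith)).trans (by linarith)⟩)
    hγ hreg hq (by linarith) (by linarith) (by linarith) hcut
  have hrate : ((q + 1) * (D * s n) / C₁) ^ (1 / β) = r * s n ^ (1 / β) := by
    rw [hr, ← Real.mul_rpow (by positivity) hsn0.le]
    congr 1; ring
  rw [hrate] at hUV hVU
  have hpow : 0 < s n ^ (1 / β) := by positivity
  refine (hausdorffEDist_locScale_le (hdev x hx).1 (hdev x hx).2 (hσM x hx) hbd hUV hVU).trans_lt ?_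
  rw [ENNReal.ofReal_lt_ofReal_iff_of_nonneg (by positivity)]
  change _ < (k + k * (4 * R) + 2 * Real.sqrt Mσ * r + 1) * (a n + b n + s n ^ (1 / β))
  have t1 : 0 ≤ k * (4 * R) * a n := by positivity
  have t2 : 0 ≤ (2 * Real.sqrt Mσ * r) * (a n + b n) := by positivity
  have t3 : 0 ≤ (k : ℝ) * b n := by positivity
  have t4 : 0 ≤ (k + k * (4 * R)) * s n ^ (1 / β) := by positivity
  linarith
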